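/- **Lemma.** Terminal Steiner Tree parameterized by $k+|T|$ is fixed-parameter tractable. Here an instance of Terminal Steiner Tree consists of a finite simple undirected graph $G=(V,E)$, a set $T\subseteq V$ of terminals and a positive integer $k$, and the question is whether $G$ has a subgraph $H$ with at most $k+|T|$ vertices such that $H$ is a tree, $H$ contains all vertices of $T$, and every vertex of $T$ is a leaf of $H$ (that is, has degree exactly one in $H$). The claim is that there are an algorithm, a computable function $f:\mathbb{N}\to\mathbb{N}$ and a constant $c$ such that the algorithm, given a pair $(x,p)\in\{0,1\}^*\times\mathbb{N}$, decides in at most $f(p)\cdot(|x|+1)^{c}$ steps (on a random access machine with unit-cost addition, truncated subtraction and halving) whether $x$ is the binary encoding of a yes-instance $(G,T,k)$ with $k+|T|=p$. (The encoding lists $|V|$ in unary, the characteristic vector of $T$, the adjacency matrix of $G$, and $k$ in binary.) -/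

import Mathlib

/-! ### Random access machines with a step count

Structured programs for the usual random access machine: registers and an addressable memory hold
natural numbers, and the arithmetic instructions are addition, truncated subtraction and halving,
each counted as one step. There is no multiplication, so that a number occurring after `t` steps has
`O(t)` more bits than the numbers of the input, and running times agree with those of Turing
machines up to a polynomial. -/

namespace RAM

/-- The configuration of a random access machine. -/
structure State where
  /-- the registers, addressed directly -/
  reg : ℕ → ℕ
  /-- the memory, addressed through registers -/
  mem : ℕ → ℕ

namespace State

def setReg (s : State) (r v : ℕ) : State := { s with reg := Function.update s.reg r v }

def setMem (s : State) (a v : ℕ) : State := { s with mem := Function.update s.mem a v }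

end State

/-- Programs. Only finitely many registers occur in a program. -/
inductive Prog where
  | skip : Prog
  /-- `reg r := c` -/
  | const (r c : ℕ) : Prog
  /-- `reg r := reg a + reg b` -/
  | add (r a b : ℕ) : Prog
  /-- `reg r := max (reg a - reg b) 0` -/
  | sub (r a b : ℕ) : Prog
  /-- `reg r := ⌊reg a / 2⌋` -/
  | half (r a : ℕ) : Prog
  /-- `reg r := mem (reg a)` -/
  | load (r a : ℕ) : Prog
  /-- `mem (reg a) := reg b` -/
  | store (a b : ℕ) : Prog
  /-- `p` followed by `q` -/
  | seq (p q : Prog) : Prog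
  /-- `p` if `reg a ≠ 0`, and `q` otherwise -/
  | cond (a : ℕ) (p q : Prog) : Prog
  /-- repeat `p` as long as `reg a ≠ 0` -/
  | loop (a : ℕ) (p : Prog) : Prog

/-- `Runs p s s' t`: started in `s`, the program `p` halts in `s'` after exactly `t` steps. Every
instruction and every evaluation of a test is one step. -/
inductive Runs : Prog → State → State → ℕ → Prop
  | skip (s : State) : Runs .skip s s 1
  | const (r c : ℕ) (s : State) : Runs (.const r c) s (s.setReg r c) 1
  | add (r a b : ℕ) (s : State) : Runs (.add r a b) s (s.setReg r (s.reg a + s.reg b)) 1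
  | sub (r a b : ℕ) (s : State) : Runs (.sub r a b) s (s.setReg r (s.reg a - s.reg b)) 1
  | half (r a : ℕ) (s : State) : Runs (.half r a) s (s.setReg r (s.reg a / 2)) 1
  | load (r a : ℕ) (s : State) : Runs (.load r a) s (s.setReg r (s.mem (s.reg a))) 1
  | store (a b : ℕ) (s : State) : Runs (.store a b) s (s.setMem (s.reg a) (s.reg b)) 1
  | seq {p q : Prog} {s s' s'' : State} {t t' : ℕ} :
      Runs p s s' t → Runs q s' s'' t' → Runs (.seq p q) s s'' (t + t')
  | condTrue {a : ℕ} {p q : Prog} {s s' : State} {t : ℕ} :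
      s.reg a ≠ 0 → Runs p s s' t → Runs (.cond a p q) s s' (t + 1)
  | condFalse {a : ℕ} {p q : Prog} {s s' : State} {t : ℕ} :
      s.reg a = 0 → Runs q s s' t → Runs (.cond a p q) s s' (t + 1)
  | loopDone {a : ℕ} {p : Prog} {s : State} :
      s.reg a = 0 → Runs (.loop a p) s s 1
  | loopStep {a : ℕ} {p : Prog} {s s' s'' : State} {t t' : ℕ} :
      s.reg a ≠ 0 → Runs p s s' t → Runs (.loop a p) s' s'' t' →
        Runs (.loop a p) s s'' (t + t' + 1)

/-- Programs are deterministic: the final state and the number of steps are determined by the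
program and the initial state. -/
theorem Runs.deterministic {p : Prog} {s s₁ s₂ : State} {t₁ t₂ : ℕ}
    (h₁ : Runs p s s₁ t₁) (h₂ : Runs p s s₂ t₂) : s₁ = s₂ ∧ t₁ = t₂ := by
  induction h₁ generalizing s₂ t₂ with
  | seq _ _ ih ih' =>
    cases h₂ with
    | seq k k' =>
      obtain ⟨rfl, rfl⟩ := ih k
      obtain ⟨rfl, rfl⟩ := ih' k'
      exact ⟨rfl, rfl⟩
  | condTrue ha _ ih =>
    cases h₂ with
    | condTrue _ k => obtain ⟨rfl, rfl⟩ := ih k; exact ⟨rfl, rfl⟩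
    | condFalse hb _ => exact absurd hb ha
  | condFalse ha _ ih =>
    cases h₂ with
    | condTrue hb _ => exact absurd ha hb
    | condFalse _ k => obtain ⟨rfl, rfl⟩ := ih k; exact ⟨rfl, rfl⟩
  | loopDone ha =>
    cases h₂ with
    | loopDone _ => exact ⟨rfl, rfl⟩
    | loopStep hb _ _ => exact absurd ha hb
  | loopStep ha _ _ ih ih' =>
    cases h₂ with
    | loopDone hb => exact absurd hb ha
    | loopStep _ k k' =>
      obtain ⟨rfl, rfl⟩ := ih k
      obtain ⟨rfl, rfl⟩ := ih' k'
      exact ⟨rfl, rfl⟩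
  | _ => cases h₂; exact ⟨rfl, rfl⟩

/-- The initial state on input `(x, k)`: register `0` holds `|x|`, register `1` holds `k`, the bits
of `x` are the first `|x|` memory cells, and everything else is `0`. -/
def init (x : List Bool) (k : ℕ) : State where
  reg r := if r = 0 then x.length else if r = 1 then k else 0
  mem i := if x[i]? = some true then 1 else 0

end RAM

/-- A parameterized problem is a set of pairs `(x, k)` of a binary string and a parameter. -/
abbrev ParamProblem : Type := Set (List Bool × ℕ)

/-- A parameterized problem is fixed-parameter tractable if some program decides every `(x, k)` in
`f(k) * |x| ^ O(1)` steps, for a computable function `f`. The program accepts if it halts with a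
nonzero value in register `0`. (`|x| + 1` instead of `|x|` accounts for the empty string.) -/
def ParamProblem.IsFPT (L : ParamProblem) : Prop :=
  ∃ (p : RAM.Prog) (f : ℕ → ℕ) (c : ℕ), Computable f ∧
    ∀ (x : List Bool) (k : ℕ), ∃ (s : RAM.State) (t : ℕ),
      RAM.Runs p (RAM.init x k) s t ∧
      t ≤ f k * (x.length + 1) ^ c ∧
      (s.reg 0 ≠ 0 ↔ (x, k) ∈ L)

/-! ### Terminal Steiner Tree -/

/-- An instance: a finite undirected graph, a set of terminals and a positive integer. -/
structure TSTInstance where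
  n : ℕ
  G : SimpleGraph (Fin n)
  T : Finset (Fin n)
  k : ℕ
  k_pos : 0 < k

namespace TSTInstance

/-- `H` is a terminal Steiner tree for `T`: it is a tree and each vertex of `T` is a leaf of `H`,
that is, a vertex of `H` of degree one in `H`. -/
def IsTerminalSteinerTree {V : Type*} {G : SimpleGraph V} (T : Finset V) (H : G.Subgraph) : Prop :=
  H.coe.IsTree ∧ ∀ v ∈ T, v ∈ H.verts ∧ (H.neighborSet v).ncard = 1

/-- There is a terminal Steiner tree with at most `k + |T|` vertices. -/
def IsYes (I : TSTInstance) : Prop :=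
  ∃ H : I.G.Subgraph, IsTerminalSteinerTree I.T H ∧ H.verts.ncard ≤ I.k + I.T.card

/-- The parameter `k + |T|`. -/
def param (I : TSTInstance) : ℕ := I.k + I.T.card

open Classical in
/-- The instance as a binary string: `n` in unary, ended by a `0`; the characteristic vector of `T`;
the adjacency matrix of `G`, row by row; and `k` in binary, least significant bit first. -/
noncomputable def encode (I : TSTInstance) : List Bool :=
  List.replicate I.n true ++ [false] ++
    List.ofFn (fun v : Fin I.n => decide (v ∈ I.T)) ++
    (List.ofFn fun u : Fin I.n => List.ofFn fun v : Fin I.n => decide (I.G.Adj u v)).flatten ++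
    I.k.bits

end TSTInstance

/-- Terminal Steiner Tree parameterized by `k + |T|`. -/
def terminalSteinerTree : ParamProblem :=
  {y | ∃ I : TSTInstance, I.encode = y.1 ∧ I.param = y.2 ∧ I.IsYes}

/-! ### Terminal Steiner trees and connected sets of non-terminals -/

/-! Removing the leaves in `T` from a terminal Steiner tree leaves a connected set `S` of at most
`k` non-terminals, and every terminal is adjacent to `S`. The only exception is a single edge
joining two terminals, because two adjacent leaves already form a whole component. Conversely, if
such an `S` is given, hang every terminal on `S` by one chosen edge and take a spanning tree: the
terminals are leaves of it (`dichotomy`, `exists_isTerminalSteinerTree`).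

A connected set of at most `k` vertices is the image of a rooted tree with nodes `0, …, k - 1`, each
node after the root having a smaller parent and being mapped to a vertex adjacent or equal to the
image of its parent. Repetitions are harmless, since only an upper bound on the size is asked for;
so homomorphisms suffice and injectivity need not be enforced. The `i`-th terminal becomes node `k +
i`, attached to a node below `k`. Hence, apart from the exceptional edge, the instance is a
yes-instance iff one of the parent functions on `p = k + |T|` nodes admits such a homomorphism
(`isYes_iff`).

There are at most `p ^ p` parent functions to try. For a fixed one, the nodes are eliminated from
the last to the first: the domain of the parent shrinks to the vertices with a partner in the domain
of the removed node (`treeHom_succ_iff`), and a homomorphism exists iff the domain of the root is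
nonempty at the end. This takes polynomial time per tree once its number is decoded.

The rest makes this an actual program. Strings that encode instances are characterized by conditions
on single bits (`mem_terminalSteinerTree_iff`), a Hoare logic with time bounds (`Tot`) is derived
for the machine, and each routine is verified in it. -/

namespace TSTInstance

section Graph

variable {V : Type*} {G : SimpleGraph V}

/-- A connected set of non-terminals that dominates the terminals extends to a terminal Steiner
tree. -/
theorem exists_isTerminalSteinerTree (S : Set V) (T : Finset V) (hST : ∀ v ∈ S, v ∉ T)
    (hS : (G.induce S).Connected) (hdom : ∀ t ∈ T, ∃ s ∈ S, G.Adj t s) :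
    ∃ H : G.Subgraph, IsTerminalSteinerTree T H ∧ H.verts = S ∪ T := by
  classical
  choose! att hattS hatt using hdom
  let W : Set V := S ∪ T
  -- All edges inside `S` are kept, but only the chosen edge at each terminal. A terminal then has
  -- at most one neighbor in every spanning tree.
  let rel : V → V → Prop := fun a b => (a ∈ S ∧ b ∈ S ∧ G.Adj a b) ∨
    (a ∈ T ∧ b = att a) ∨ (b ∈ T ∧ a = att b)
  have hrel : ∀ {a b}, rel a b → G.Adj a b := by
    rintro a b (h | ⟨h, rfl⟩ | ⟨h, rfl⟩)
    · exact h.2.2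
    · exact hatt _ h
    · exact (hatt _ h).symm
  let K : SimpleGraph W :=
    { Adj := fun a b => rel a b
      symm := ⟨by
        rintro a b (h | h | h)
        · exact Or.inl ⟨h.2.1, h.1, h.2.2.symm⟩
        · exact Or.inr (Or.inr h)
        · exact Or.inr (Or.inl h)⟩
      loopless := ⟨fun a h => (hrel h).ne rfl⟩ }
  obtain ⟨r⟩ := hS.nonempty
  let f : G.induce S →g K :=
    { toFun := fun v => ⟨v, Or.inl v.2⟩
      map_rel' := fun {a b} h => Or.inl ⟨a.2, b.2, h⟩ }
  have hreachS : ∀ (v : V) (hv : v ∈ S), K.Reachable (f r) ⟨v, Or.inl hv⟩ := fun v hv =>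
    (hS.preconnected r ⟨v, hv⟩).map f
  have hreach : ∀ w : W, K.Reachable (f r) w := by
    rintro ⟨w, hw | hw⟩
    · exact hreachS w hw
    · refine (hreachS (att w) (hattS w hw)).trans (SimpleGraph.Adj.reachable ?_)
      exact Or.inr (Or.inr ⟨hw, rfl⟩)
  have hK : K.Connected := by
    have : Nonempty W := ⟨f r⟩
    exact ⟨fun a b => (hreach a).symm.trans (hreach b)⟩
  obtain ⟨K', hle, hK'⟩ := hK.exists_isTree_le
  let H : G.Subgraph :=
    { verts := W
      Adj := fun a b => ∃ (ha : a ∈ W) (hb : b ∈ W), K'.Adj ⟨a, ha⟩ ⟨b, hb⟩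
      adj_sub := by rintro a b ⟨_, _, h⟩; exact hrel (hle h)
      edge_vert := by rintro a b ⟨ha, _, _⟩; exact ha
      symm := ⟨by rintro a b ⟨ha, hb, h⟩; exact ⟨hb, ha, h.symm⟩⟩ }
  have hcoe : H.coe = K' := by
    ext a b
    constructor
    · rintro ⟨_, _, h⟩; exact h
    · intro h; exact ⟨a.2, b.2, h⟩
  refine ⟨H, ⟨by rw [hcoe]; exact hK', fun t ht => ⟨Or.inr ht, ?_⟩⟩, rfl⟩
  rw [Set.ncard_eq_one]
  refine ⟨att t, ?_⟩
  have hsub : ∀ x, H.Adj t x → x = att t := by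
    rintro x ⟨_, _, h⟩
    rcases hle h with h | h | h
    · exact absurd ht (hST t h.1)
    · exact h.2
    · exact absurd ht (hST t (by have := hattS x h.1; rwa [← h.2] at this))
  ext x
  refine ⟨fun h => hsub x h, ?_⟩
  rintro rfl
  -- So far `t` has at most one neighbor. It has one at all because the tree is connected and also
  -- contains `r`.
  have hne : (⟨t, Or.inr ht⟩ : W) ≠ f r := by
    intro h
    exact hST r r.2 ((congrArg Subtype.val h) ▸ ht)
  have : Nontrivial W := ⟨_, _, hne⟩
  obtain ⟨y, hy⟩ := hK'.connected.preconnected.exists_adj_of_nontrivial ⟨t, Or.inr ht⟩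
  have hty : H.Adj t y := ⟨Or.inr ht, y.2, hy⟩
  have := hsub _ hty
  rw [← this]; exact hty

/-- A terminal Steiner tree is a single edge between two terminals, or its non-terminals form a
connected set that dominates the terminals. -/
theorem IsTerminalSteinerTree.dichotomy {T : Finset V} {H : G.Subgraph}
    (h : IsTerminalSteinerTree T H) :
    (T.card = 2 ∧ ∃ u ∈ T, ∃ v ∈ T, G.Adj u v) ∨
      ((G.induce (H.verts \ T)).Connected ∧ ∀ t ∈ T, ∃ s ∈ H.verts \ T, G.Adj t s) := by
  classical
  obtain ⟨htree, hleaf⟩ := h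
  have hadj : ∀ t ∈ T, ∃ y, H.Adj t y ∧ ∀ z, H.Adj t z → z = y := by
    intro t ht
    obtain ⟨y, hy⟩ := Set.ncard_eq_one.1 (hleaf t ht).2
    refine ⟨y, ?_, fun z hz => ?_⟩
    · have : y ∈ H.neighborSet t := by rw [hy]; rfl
      exact this
    · have : z ∈ H.neighborSet t := hz
      rw [hy] at this; exact this
  have hconn := htree.connected
  by_cases hS : (H.verts \ (T : Set V)).Nonempty
  · right
    obtain ⟨r, hr⟩ := hS
    let S : Set V := H.verts \ T
    let reach : V → Prop := fun w => ∃ hw : w ∈ S, (G.induce S).Reachable ⟨r, hr⟩ ⟨w, hw⟩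
    -- Induction along a walk from `r` in `H`. The walk may enter a terminal, but from a leaf it can
    -- only turn back; so at a terminal the invariant speaks of its neighbor instead.
    have key : ∀ w : H.verts, H.coe.Reachable ⟨r, hr.1⟩ w →
        (w.1 ∉ T → reach w) ∧ (w.1 ∈ T → ∀ y, H.Adj w y → reach y) := by
      intro w hw
      rw [SimpleGraph.reachable_iff_reflTransGen] at hw
      induction hw with
      | refl => exact ⟨fun _ => ⟨hr, SimpleGraph.Reachable.refl _⟩, fun h => absurd h hr.2⟩
      | @tail a b _ hab ih =>
        have hab' : H.Adj a b := hab
        refine ⟨fun hb => ?_, fun hb y hy => ?_⟩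
        · by_cases ha : a.1 ∈ T
          · exact ih.2 ha b hab'
          · obtain ⟨haS, hra⟩ := ih.1 ha
            refine ⟨⟨b.2, hb⟩, hra.trans (SimpleGraph.Adj.reachable ?_)⟩
            exact hab'.adj_sub
        · obtain ⟨z, _, hz⟩ := hadj b hb
          have hya : y = a := (hz y hy).trans (hz a hab'.symm).symm
          subst hya
          by_cases ha : a.1 ∈ T
          · obtain ⟨hbS, _⟩ := ih.2 ha b hab'
            exact absurd hb hbS.2
          · exact ih.1 ha
    refine ⟨?_, fun t ht => ?_⟩
    · have : Nonempty S := ⟨⟨r, hr⟩⟩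
      have hall : ∀ w : S, (G.induce S).Reachable ⟨r, hr⟩ w := fun w =>
        ((key ⟨w, w.2.1⟩ (hconn.preconnected _ _)).1 w.2.2).2
      exact ⟨fun a b => (hall a).symm.trans (hall b)⟩
    · obtain ⟨y, hy, _⟩ := hadj t ht
      obtain ⟨hyS, _⟩ := (key ⟨t, (hleaf t ht).1⟩ (hconn.preconnected _ _)).2 ht y hy
      exact ⟨y, hyS, hy.adj_sub⟩
  · left
    have hsub : ∀ v ∈ H.verts, v ∈ T := fun v hv => by
      by_contra hvT
      exact hS ⟨v, hv, hvT⟩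
    obtain ⟨u⟩ := hconn.nonempty
    obtain ⟨y, hy, huy⟩ := hadj u (hsub u u.2)
    have hyT : y ∈ T := hsub y hy.snd_mem
    obtain ⟨z, _, hz⟩ := hadj y hyT
    have hzu : z = u := (hz u hy.symm).symm
    subst hzu
    -- All vertices are leaves here, so `u` and `y` are each other's only neighbors and no walk from
    -- `u` leaves the pair.
    have hall : ∀ w : H.verts, w.1 = u ∨ w.1 = y := by
      intro w
      have hw := hconn.preconnected u w
      rw [SimpleGraph.reachable_iff_reflTransGen] at hw
      induction hw with
      | refl => exact Or.inl rfl
      | @tail a b _ hab ih =>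
        have hab' : H.Adj a b := hab
        rcases ih with ha | ha
        · right; exact huy b (ha ▸ hab')
        · left; exact hz b (ha ▸ hab')
    have hT : T = {u.1, y} := by
      ext w
      simp only [Finset.mem_insert, Finset.mem_singleton]
      refine ⟨fun hw => hall ⟨w, (hleaf w hw).1⟩, ?_⟩
      rintro (rfl | rfl)
      · exact hsub u u.2
      · exact hyT
    refine ⟨?_, u, hsub u u.2, y, hyT, hy.adj_sub⟩
    rw [hT, Finset.card_pair hy.adj_sub.ne]

/-- An edge between the only two terminals is a terminal Steiner tree. -/
theorem isTerminalSteinerTree_subgraphOfAdj [DecidableEq V] {u v : V} (h : G.Adj u v) :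
    IsTerminalSteinerTree {u, v} (G.subgraphOfAdj h) := by
  refine ⟨SimpleGraph.IsTree.coe_subgraphOfAdj h, fun w hw => ?_⟩
  simp only [Finset.mem_insert, Finset.mem_singleton] at hw
  refine ⟨by simpa using hw, ?_⟩
  rcases hw with rfl | rfl
  · rw [SimpleGraph.neighborSet_fst_subgraphOfAdj, Set.ncard_singleton]
  · rw [SimpleGraph.neighborSet_snd_subgraphOfAdj, Set.ncard_singleton]

/-- A sequence each of whose members before `k` is equal or adjacent to an earlier member has a
connected set of values. -/
theorem connected_of_parent {k : ℕ} (hk : 0 < k) (φ : ℕ → V) (par : ℕ → ℕ)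
    (hpar : ∀ j, 1 ≤ j → j < k → par j < j)
    (hadj : ∀ j, 1 ≤ j → j < k → G.Adj (φ (par j)) (φ j) ∨ φ (par j) = φ j) :
    (G.induce (φ '' Set.Iio k)).Connected := by
  have hmem : ∀ j, j < k → φ j ∈ φ '' Set.Iio k := fun j hj => ⟨j, hj, rfl⟩
  have hreach : ∀ j (hj : j < k),
      (G.induce (φ '' Set.Iio k)).Reachable ⟨φ 0, hmem 0 hk⟩ ⟨φ j, hmem j hj⟩ := by
    intro j
    induction j using Nat.strong_induction_on with
    | _ j ih =>
      intro hj
      rcases Nat.eq_zero_or_pos j with rfl | h0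
      · exact SimpleGraph.Reachable.refl _
      · have hp := hpar j h0 hj
        have hr := ih (par j) hp (hp.trans hj)
        rcases hadj j h0 hj with h | h
        · exact hr.trans (SimpleGraph.Adj.reachable h)
        · convert hr using 2
          exact h.symm
  have : Nonempty (φ '' Set.Iio k) := ⟨⟨φ 0, hmem 0 hk⟩⟩
  refine ⟨?_⟩
  rintro ⟨_, a, ha, rfl⟩ ⟨_, b, hb, rfl⟩
  exact (hreach a ha).symm.trans (hreach b hb)

/-- A connected set with at most `k` elements can be listed, with repetitions, such that every
member is equal or adjacent to an earlier one. -/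
theorem exists_parent_of_connected {S : Set V} (hfin : S.Finite) (hS : (G.induce S).Connected)
    {k : ℕ} (hk : S.ncard ≤ k) :
    ∃ (φ : ℕ → V) (par : ℕ → ℕ), φ '' Set.Iio k = S ∧
      (∀ j, 1 ≤ j → par j < j) ∧
      ∀ j, 1 ≤ j → j < k → G.Adj (φ (par j)) (φ j) ∨ φ (par j) = φ j := by
  classical
  obtain ⟨r⟩ := hS.nonempty
  have hpos : 0 < S.ncard := (Set.ncard_pos hfin).2 ⟨r, r.2⟩
  -- Greedy growth: either `S` is already exhausted, or all `i + 1` entries so far are distinct. An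
  -- exhausted list is padded by repeating `φ 0`.
  have main : ∀ i, ∃ (φ : ℕ → V) (par : ℕ → ℕ), φ '' Set.Iio (i + 1) ⊆ S ∧
      (φ '' Set.Iio (i + 1) = S ∨ i + 1 ≤ (φ '' Set.Iio (i + 1)).ncard) ∧
      (∀ j, 1 ≤ j → par j < j) ∧
      ∀ j, 1 ≤ j → j < i + 1 → G.Adj (φ (par j)) (φ j) ∨ φ (par j) = φ j := by
    intro i
    induction i with
    | zero =>
      refine ⟨fun _ => r, fun _ => 0, ?_, Or.inr ?_, fun j hj => hj, fun _ _ _ => Or.inr rfl⟩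
      · rintro _ ⟨_, _, rfl⟩; exact r.2
      · have : (fun _ : ℕ => r.1) '' Set.Iio (0 + 1) = {r.1} := by
          ext x; simp
        rw [this, Set.ncard_singleton]
    | succ i ih =>
      obtain ⟨φ, par, hsub, hcard, hpar, hadj⟩ := ih
      have extend : ∀ (a : ℕ) (w : V), a < i + 1 → w ∈ S →
          (G.Adj (φ a) w ∨ φ a = w) →
          (insert w (φ '' Set.Iio (i + 1)) = S ∨
            i + 1 + 1 ≤ (insert w (φ '' Set.Iio (i + 1))).ncard) →
          ∃ (φ : ℕ → V) (par : ℕ → ℕ), φ '' Set.Iio (i + 1 + 1) ⊆ S ∧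
          (φ '' Set.Iio (i + 1 + 1) = S ∨ i + 1 + 1 ≤ (φ '' Set.Iio (i + 1 + 1)).ncard) ∧
          (∀ j, 1 ≤ j → par j < j) ∧
          ∀ j, 1 ≤ j → j < i + 1 + 1 → G.Adj (φ (par j)) (φ j) ∨ φ (par j) = φ j := by
        intro a w ha hw haw hc
        have himg : Function.update φ (i + 1) w '' Set.Iio (i + 1 + 1) =
            insert w (φ '' Set.Iio (i + 1)) := by
          ext x
          simp only [Set.mem_image, Set.mem_Iio, Set.mem_insert_iff]
          constructor
          · rintro ⟨j, hj, rfl⟩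
            rcases Nat.lt_succ_iff_lt_or_eq.1 hj with h | rfl
            · right; exact ⟨j, h, by rw [Function.update_of_ne h.ne]⟩
            · left; simp
          · rintro (rfl | ⟨j, hj, rfl⟩)
            · exact ⟨i + 1, by omega, by simp⟩
            · exact ⟨j, by omega, by rw [Function.update_of_ne hj.ne]⟩
        refine ⟨Function.update φ (i + 1) w, Function.update par (i + 1) a, ?_, ?_, ?_, ?_⟩
        · rw [himg]; exact Set.insert_subset hw hsub
        · rw [himg]; exact hc
        · intro j hj
          rcases eq_or_ne j (i + 1) with rfl | hne
          · simpa using ha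
          · rw [Function.update_of_ne hne]; exact hpar j hj
        · intro j hj hj'
          rcases eq_or_ne j (i + 1) with rfl | hne
          · simpa [Function.update_of_ne ha.ne] using haw
          · have hlt : j < i + 1 := by omega
            have := hpar j hj
            rw [Function.update_of_ne hne, Function.update_of_ne hne,
              Function.update_of_ne (by omega)]
            exact hadj j hj hlt
      by_cases hall : φ '' Set.Iio (i + 1) = S
      · refine extend 0 (φ 0) (by omega) (hsub ⟨0, by simp, rfl⟩) (Or.inr rfl) (Or.inl ?_)
        rw [Set.insert_eq_of_mem (Set.mem_image_of_mem φ (by simp)), hall]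
      · have hcard' := hcard.resolve_left hall
        obtain ⟨y, hyS, hy⟩ : ∃ y ∈ S, y ∉ φ '' Set.Iio (i + 1) := by
          by_contra hcon
          push Not at hcon
          exact hall (hsub.antisymm hcon)
        have hφ0 : φ 0 ∈ S := hsub ⟨0, by simp, rfl⟩
        -- Connectedness yields an edge of `S` leaving the vertices listed so far; its outer end is
        -- the next entry.
        have hcross : ∃ a b : S, (G.induce S).Adj a b ∧ a.1 ∈ φ '' Set.Iio (i + 1) ∧
            b.1 ∉ φ '' Set.Iio (i + 1) := by
          by_contra hcon
          push Not at hcon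
          have hr := hS.preconnected ⟨φ 0, hφ0⟩ ⟨y, hyS⟩
          rw [SimpleGraph.reachable_iff_reflTransGen] at hr
          have : ∀ b : S, Relation.ReflTransGen (G.induce S).Adj ⟨φ 0, hφ0⟩ b →
              b.1 ∈ φ '' Set.Iio (i + 1) := by
            intro b hb
            induction hb with
            | refl => exact ⟨0, by simp, rfl⟩
            | tail _ hab ih => exact hcon _ _ hab ih
          exact hy (this _ hr)
        obtain ⟨a, b, hab, ⟨j, hj, hja⟩, hb⟩ := hcross
        refine extend j b hj b.2 (Or.inl ?_) (Or.inr ?_)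
        · rw [hja]; exact hab
        · rw [Set.ncard_insert_of_notMem hb (hfin.subset hsub)]
          omega
  obtain ⟨φ, par, hsub, hcard, hpar, hadj⟩ := main (k - 1)
  have hk1 : k - 1 + 1 = k := by omega
  rw [hk1] at hsub hcard hadj
  refine ⟨φ, par, ?_, hpar, hadj⟩
  rcases hcard with h | h
  · exact h
  · exact Set.eq_of_subset_of_ncard_le hsub (hk.trans h) hfin

end Graph

end TSTInstance

/-! ### Homomorphisms from trees with a parent function -/

/-- Assignments of the nodes `0, …, J - 1` of the tree with parent function `par` to vertices in
their domains, such that each node is adjacent or equal to its parent. -/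
def TreeHom (D A : ℕ → ℕ → Prop) (par : ℕ → ℕ) (J : ℕ) : Prop :=
  ∃ φ : ℕ → ℕ, (∀ j < J, D j (φ j)) ∧
    ∀ j, 1 ≤ j → j < J → A (φ (par j)) (φ j) ∨ φ (par j) = φ j

/-- The last node of the tree can be eliminated by shrinking the domain of its parent. -/
theorem treeHom_succ_iff {D D' A : ℕ → ℕ → Prop} {par : ℕ → ℕ} {J : ℕ}
    (hpar : ∀ j, 1 ≤ j → j ≤ J → par j < j) (hJ : 1 ≤ J)
    (hD : ∀ j < J, j ≠ par J → ∀ v, D' j v ↔ D j v)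
    (hD' : ∀ v, D' (par J) v ↔ D (par J) v ∧ ∃ u, D J u ∧ (A v u ∨ v = u)) :
    TreeHom D A par (J + 1) ↔ TreeHom D' A par J := by
  constructor
  · rintro ⟨φ, h1, h2⟩
    refine ⟨φ, fun j hj => ?_, fun j hj hj' => h2 j hj (by omega)⟩
    by_cases h : j = par J
    · subst h
      rw [hD']
      exact ⟨h1 _ (by omega), φ J, h1 J (by omega), h2 J hJ (by omega)⟩
    · rw [hD j hj h]; exact h1 j (by omega)
  · rintro ⟨φ, h1, h2⟩
    have hp := hpar J hJ le_rfl
    obtain ⟨hv, u, hu, huv⟩ := (hD' _).1 (h1 _ hp)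
    refine ⟨Function.update φ J u, fun j hj => ?_, fun j hj hj' => ?_⟩
    · rcases eq_or_ne j J with rfl | hne
      · simpa using hu
      · rw [Function.update_of_ne hne]
        by_cases h : j = par J
        · subst h; exact hv
        · exact (hD j (by omega) h _).1 (h1 j (by omega))
    · have hlt := hpar j hj (by omega)
      rw [Function.update_of_ne (by omega : par j ≠ J)]
      rcases eq_or_ne j J with rfl | hne
      · simpa using huv
      · rw [Function.update_of_ne hne]; exact h2 j hj (by omega)

open Classical in
/-- The domain of node `j`: the nodes below `k` are assigned to non-terminals, the node `k + i` to
the `i`-th terminal. -/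
def slot (n k : ℕ) (T : ℕ → Prop) (j v : ℕ) : Prop :=
  v < n ∧ ((¬ T v ∧ j < k) ∨ (T v ∧ j = k + Nat.count T v))

theorem Nat.exists_count_eq {T : ℕ → Prop} [DecidablePred T] {n i : ℕ} (h : i < Nat.count T n) :
    ∃ v < n, T v ∧ Nat.count T v = i := by
  induction n with
  | zero => simp at h
  | succ n ih =>
    rw [Nat.count_succ] at h
    by_cases hi : i < Nat.count T n
    · obtain ⟨v, hv, h'⟩ := ih hi
      exact ⟨v, by omega, h'⟩
    · split_ifs at h with hT
      · exact ⟨n, by omega, hT, by omega⟩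
      · omega

namespace TSTInstance

/-- The terminals as natural numbers. -/
def term (I : TSTInstance) (v : ℕ) : Prop := ∃ h : v < I.n, (⟨v, h⟩ : Fin I.n) ∈ I.T

/-- Adjacency of natural numbers below `n`. -/
def adj (I : TSTInstance) (u v : ℕ) : Prop :=
  ∃ (hu : u < I.n) (hv : v < I.n), I.G.Adj ⟨u, hu⟩ ⟨v, hv⟩

open Classical in
theorem count_term (I : TSTInstance) : Nat.count I.term I.n = I.T.card := by
  rw [Nat.count_eq_card_filter_range]
  refine (Finset.card_bij (fun (v : Fin I.n) _ => (v : ℕ)) ?_ ?_ ?_).symm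
  · intro v hv
    simp only [Finset.mem_filter, Finset.mem_range]
    exact ⟨v.2, v.2, hv⟩
  · intro a _ b _ h
    exact Fin.ext h
  · intro b hb
    simp only [Finset.mem_filter, Finset.mem_range] at hb
    obtain ⟨_, h, hT⟩ := hb
    exact ⟨⟨b, h⟩, hT, rfl⟩

/-- The first `k` nodes map onto a connected set of non-terminals. The domain of node `k + i` is a
single terminal, and the image of its parent is a non-terminal, so of "adjacent or equal" only
adjacency remains: the set dominates `T`. -/
theorem isYes_of_treeHom (I : TSTInstance) {par : ℕ → ℕ}
    (hpar : ∀ j, 1 ≤ j → j < I.param → par j < j ∧ par j < I.k)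
    (h : TreeHom (slot I.n I.k I.term) I.adj par I.param) : I.IsYes := by
  classical
  obtain ⟨φ, h1, h2⟩ := h
  have hkp : I.k ≤ I.param := Nat.le_add_right _ _
  have hk := I.k_pos
  have hn : ∀ j, j < I.param → φ j < I.n := fun j hj => (h1 j hj).1
  -- Outside the `param` nodes the value is irrelevant; `φ 0` serves as default and exists because
  -- `k` is positive.
  let ψ : ℕ → Fin I.n := fun j => if h : φ j < I.n then ⟨φ j, h⟩ else ⟨φ 0, hn 0 (by omega)⟩
  have hψ : ∀ j (hj : j < I.param), ψ j = ⟨φ j, hn j hj⟩ := fun j hj => dif_pos (hn j hj)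
  have hadj : ∀ j, 1 ≤ j → j < I.param → I.G.Adj (ψ (par j)) (ψ j) ∨ ψ (par j) = ψ j := by
    intro j hj hj'
    have hp := hpar j hj hj'
    rw [hψ j hj', hψ (par j) (by omega)]
    rcases h2 j hj hj' with ⟨_, _, h⟩ | h
    · exact Or.inl h
    · exact Or.inr (Fin.ext h)
  have hT : ∀ j, j < I.k → ψ j ∉ I.T := by
    intro j hj hmem
    rw [hψ j (by omega)] at hmem
    rcases (h1 j (by omega)).2 with h | h
    · exact h.1 ⟨_, hmem⟩
    · omega
  have hconn := connected_of_parent (G := I.G) hk ψ par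
    (fun j hj hj' => (hpar j hj (by omega)).1) (fun j hj hj' => hadj j hj (by omega))
  obtain ⟨H, hH, hverts⟩ := exists_isTerminalSteinerTree (ψ '' Set.Iio I.k) I.T
    (by rintro _ ⟨j, hj, rfl⟩; exact hT j hj) hconn (by
      intro t ht
      have htt : I.term t := ⟨t.2, ht⟩
      have hlt : Nat.count I.term t < I.T.card := by
        rw [← I.count_term]; exact Nat.count_strict_mono htt t.2
      have hj : I.k + Nat.count I.term t < I.param := Nat.add_lt_add_left hlt _
      have hslot := h1 _ hj
      have hφ : φ (I.k + Nat.count I.term t) = t := by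
        rcases hslot.2 with h | h
        · omega
        · exact (Nat.count_injective htt h.1 (by omega)).symm
      have hψt : ψ (I.k + Nat.count I.term t) = t := by
        rw [hψ _ hj]; exact Fin.ext hφ
      have hp := hpar _ (by omega) hj
      refine ⟨_, ⟨_, hp.2, rfl⟩, ?_⟩
      have := hadj _ (by omega) hj
      rw [hψt] at this
      rcases this with h | h
      · exact h.symm
      · exact absurd (by rw [h]; exact ht) (hT _ hp.2))
  refine ⟨H, hH, ?_⟩
  rw [hverts]
  refine (Set.ncard_union_le _ _).trans ?_
  rw [Set.ncard_coe_finset]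
  refine Nat.add_le_add_right ((Set.ncard_image_le (Set.finite_Iio _)).trans ?_) _
  rw [← Finset.coe_Iio, Set.ncard_coe_finset, Nat.card_Iio]

/-- The nodes below `k` list `S` with repetitions; node `k + i` goes to the `i`-th terminal, and its
parent is a node listing a neighbor of that terminal in `S`. -/
theorem exists_treeHom_of_connected (I : TSTInstance) {S : Set (Fin I.n)}
    (hconn : (I.G.induce S).Connected) (hST : ∀ v ∈ S, v ∉ I.T) (hcard : S.ncard ≤ I.k)
    (hdom : ∀ t ∈ I.T, ∃ s ∈ S, I.G.Adj t s) :
    ∃ par : ℕ → ℕ, (∀ j, 1 ≤ j → j < I.param → par j < j ∧ par j < I.k) ∧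
      TreeHom (slot I.n I.k I.term) I.adj par I.param := by
  classical
  obtain ⟨φ, par, himg, hpar, hadj⟩ := exists_parent_of_connected S.toFinite hconn hcard
  have hk := I.k_pos
  have hterm : ∀ j, I.k ≤ j → j < I.param → ∃ v, I.term v ∧ Nat.count I.term v = j - I.k := by
    intro j hj hj'
    have : j - I.k < Nat.count I.term I.n := by
      rw [I.count_term]; unfold param at hj'; omega
    obtain ⟨v, _, h⟩ := Nat.exists_count_eq this
    exact ⟨v, h⟩
  choose! τ hτ hcount using hterm
  have hatt : ∀ j, I.k ≤ j → j < I.param → ∃ a < I.k, I.adj (φ a) (τ j) := by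
    intro j hj hj'
    obtain ⟨h, hT⟩ := hτ j hj hj'
    obtain ⟨s, hs, hadj⟩ := hdom _ hT
    rw [← himg] at hs
    obtain ⟨a, ha, rfl⟩ := hs
    exact ⟨a, ha, (φ a).2, h, hadj.symm⟩
  choose! α hα hαadj using hatt
  refine ⟨fun j => if j < I.k then par j else α j, fun j hj hj' => ?_,
    fun j => if j < I.k then φ j else τ j, fun j hj => ?_, fun j hj hj' => ?_⟩
  · by_cases h : j < I.k
    · have := hpar j hj
      simp only [h, if_true]; omega
    · have := hα j (by omega) hj'
      simp only [h, if_false]; omega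
  · by_cases h : j < I.k
    · simp only [h, if_true]
      refine ⟨(φ j).2, Or.inl ⟨?_, h⟩⟩
      rintro ⟨_, hT⟩
      exact hST (φ j) (himg ▸ ⟨j, h, rfl⟩) hT
    · simp only [h, if_false]
      have hc := hcount j (by omega) hj
      refine ⟨(hτ j (by omega) hj).1, Or.inr ⟨hτ j (by omega) hj, ?_⟩⟩
      omega
  · by_cases h : j < I.k
    · have hp := hpar j hj
      simp only [h, if_true, hp.trans h]
      rcases hadj j hj h with h | h
      · exact Or.inl ⟨(φ (par j)).2, (φ j).2, h⟩
      · exact Or.inr (by rw [h])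
    · simp only [h, if_false, hα j (by omega) hj', if_true]
      exact Or.inl (hαadj j (by omega) hj')

/-- Terminal Steiner Tree as the search for a homomorphism from a rooted tree. -/
theorem isYes_iff (I : TSTInstance) : I.IsYes ↔
    (I.T.card = 2 ∧ ∃ u v, I.term u ∧ I.term v ∧ I.adj u v) ∨
      ∃ par : ℕ → ℕ, (∀ j, 1 ≤ j → j < I.param → par j < j ∧ par j < I.k) ∧
        TreeHom (slot I.n I.k I.term) I.adj par I.param := by
  classical
  constructor
  · rintro ⟨H, hH, hcard⟩
    rcases hH.dichotomy with ⟨h2, u, hu, v, hv, huv⟩ | ⟨hconn, hdom⟩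
    · exact Or.inl ⟨h2, u, v, ⟨u.2, hu⟩, ⟨v.2, hv⟩, u.2, v.2, huv⟩
    · refine Or.inr (I.exists_treeHom_of_connected hconn (fun v hv => hv.2) ?_ hdom)
      -- All terminals lie in `H`, so removing them lowers the vertex count by exactly `|T|` and
      -- leaves at most `k`.
      rw [Set.ncard_sdiff (fun t ht => (hH.2 t ht).1), Set.ncard_coe_finset]
      omega
  · rintro (⟨h2, u, v, ⟨hu, huT⟩, ⟨hv, hvT⟩, _, _, huv⟩ | ⟨par, hpar, h⟩)
    · have hT : ({⟨u, hu⟩, ⟨v, hv⟩} : Finset (Fin I.n)) = I.T := by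
        apply Finset.eq_of_subset_of_card_le
        · intro x hx
          simp only [Finset.mem_insert, Finset.mem_singleton] at hx
          rcases hx with rfl | rfl <;> assumption
        · rw [h2, Finset.card_pair huv.ne]
      refine ⟨I.G.subgraphOfAdj huv, hT ▸ isTerminalSteinerTree_subgraphOfAdj huv, ?_⟩
      rw [SimpleGraph.subgraphOfAdj_verts, Set.ncard_pair huv.ne, h2]
      omega
    · exact I.isYes_of_treeHom hpar h

end TSTInstance

/-! ### Decoding instances -/

/-- The bit at position `i` of a binary string is `1`. -/
def IsOne (x : List Bool) (i : ℕ) : Prop := x[i]? = some true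

theorem IsOne.lt_length {x : List Bool} {i : ℕ} (h : IsOne x i) : i < x.length := by
  unfold IsOne at h
  exact (List.getElem?_eq_some_iff.1 h).1

theorem List.eq_of_isOne_iff {x y : List Bool} (hlen : x.length = y.length)
    (h : ∀ i < x.length, IsOne x i ↔ IsOne y i) : x = y := by
  apply List.ext_getElem hlen
  intro i hx hy
  have := h i hx
  simp only [IsOne, List.getElem?_eq_getElem hx, List.getElem?_eq_getElem hy,
    Option.some.injEq] at this
  exact Bool.eq_iff_iff.2 this

/-- The value of the last `i` bits of `x`, least significant bit first. -/
def suffixValue (x : List Bool) (i : ℕ) : ℕ :=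
  Nat.ofDigits 2 ((x.drop (x.length - i)).map fun b => bif b then 1 else 0)

theorem suffixValue_zero (x : List Bool) : suffixValue x 0 = 0 := by
  simp [suffixValue]

open Classical in
-- A Horner step: the most significant bit comes last, so reading backwards doubles the value and
-- adds the new bit.
theorem suffixValue_succ (x : List Bool) {i : ℕ} (hi : i < x.length) :
    suffixValue x (i + 1) = suffixValue x i + suffixValue x i +
      if IsOne x (x.length - (i + 1)) then 1 else 0 := by
  have hlt : x.length - (i + 1) < x.length := by omega
  have hs : x.length - (i + 1) + 1 = x.length - i := by omega
  unfold suffixValue IsOne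
  rw [List.drop_eq_getElem_cons hlt, hs, List.map_cons, Nat.ofDigits_cons,
    List.getElem?_eq_getElem hlt]
  cases x[x.length - (i + 1)] <;> simp <;> ring

/-- Turns the list of rows into one list in which entry `(u, v)` has position `u * n + v`, the
address the program computes. -/
theorem List.flatten_ofFn_ofFn {α : Type*} {m n : ℕ} (g : Fin m → Fin n → α) :
    (List.ofFn fun u => List.ofFn fun v => g u v).flatten =
      List.ofFn fun i : Fin (m * n) => g i.divNat i.modNat := by
  rw [List.ofFn_mul]
  congr 2
  ext1 u
  congr 1
  ext1 v
  have hn : 0 < n := v.pos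
  congr 1
  · apply Fin.ext
    simp only [Fin.coe_divNat]
    rw [Nat.add_comm, Nat.add_mul_div_right _ _ hn, Nat.div_eq_of_lt v.2, Nat.zero_add]
  · apply Fin.ext
    simp only [Fin.coe_modNat]
    rw [Nat.add_comm, Nat.add_mul_mod_self_right, Nat.mod_eq_of_lt v.2]

theorem Nat.mul_add_lt_mul {u v m n : ℕ} (hu : u < m) (hv : v < n) : u * n + v < m * n :=
  calc u * n + v < u * n + n := Nat.add_lt_add_left hv _
    _ = (u + 1) * n := by ring
    _ ≤ m * n := Nat.mul_le_mul_right _ hu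

theorem isOne_ofFn_iff {n : ℕ} {f : Fin n → Bool} {i : ℕ} :
    IsOne (List.ofFn f) i ↔ ∃ h : i < n, f ⟨i, h⟩ = true := by
  unfold IsOne
  by_cases h : i < n
  · rw [List.getElem?_eq_getElem (by simpa using h)]
    simp [h]
  · rw [List.getElem?_eq_none (by simpa using h)]
    simp [h]

theorem isOne_append_left {x y : List Bool} {i : ℕ} (h : i < x.length) :
    IsOne (x ++ y) i ↔ IsOne x i := by
  unfold IsOne; rw [List.getElem?_append_left h]

theorem isOne_append_right {x y : List Bool} {m i : ℕ} (h : x.length = m) :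
    IsOne (x ++ y) (m + i) ↔ IsOne y i := by
  unfold IsOne; rw [List.getElem?_append_right (by omega)]; simp [h]

namespace TSTInstance

open Classical in
theorem encode_eq (I : TSTInstance) : I.encode =
    List.replicate I.n true ++ [false] ++ List.ofFn (fun v : Fin I.n => decide (v ∈ I.T)) ++
      List.ofFn (fun i : Fin (I.n * I.n) => decide (I.G.Adj i.divNat i.modNat)) ++ I.k.bits := by
  unfold encode
  rw [List.flatten_ofFn_ofFn (fun u v => decide (I.G.Adj u v))]

theorem length_encode (I : TSTInstance) :
    I.encode.length = I.n + 1 + I.n + I.n * I.n + I.k.bits.length := by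
  rw [encode_eq]; simp; omega

theorem isOne_encode_unary (I : TSTInstance) {i : ℕ} (hi : i < I.n) : IsOne I.encode i := by
  rw [encode_eq, List.append_assoc, List.append_assoc, List.append_assoc,
    isOne_append_left (by simpa using hi)]
  simp [IsOne, hi]

theorem not_isOne_encode_n (I : TSTInstance) : ¬ IsOne I.encode I.n := by
  rw [encode_eq, List.append_assoc, List.append_assoc, List.append_assoc]
  exact fun h => absurd ((isOne_append_right (m := I.n) (i := 0) (by simp)).1 h) (by simp [IsOne])

theorem isOne_encode_term (I : TSTInstance) {v : ℕ} (hv : v < I.n) :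
    IsOne I.encode (I.n + 1 + v) ↔ I.term v := by
  rw [encode_eq, List.append_assoc, List.append_assoc, isOne_append_right (by simp),
    isOne_append_left (by simpa using hv), isOne_ofFn_iff]
  simp [term]

theorem isOne_encode_adj (I : TSTInstance) {u v : ℕ} (hu : u < I.n) (hv : v < I.n) :
    IsOne I.encode (I.n + 1 + I.n + (u * I.n + v)) ↔ I.adj u v := by
  have hn : 0 < I.n := by omega
  have hlt := Nat.mul_add_lt_mul hu hv
  rw [encode_eq, List.append_assoc, isOne_append_right (by simp; omega),
    isOne_append_left (by simpa using hlt), isOne_ofFn_iff]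
  have hd : (⟨u * I.n + v, hlt⟩ : Fin (I.n * I.n)).divNat = ⟨u, hu⟩ := by
    apply Fin.ext
    simp only [Fin.coe_divNat]
    rw [Nat.add_comm, Nat.add_mul_div_right _ _ hn, Nat.div_eq_of_lt hv, Nat.zero_add]
  have hm : (⟨u * I.n + v, hlt⟩ : Fin (I.n * I.n)).modNat = ⟨v, hv⟩ := by
    apply Fin.ext
    simp only [Fin.coe_modNat]
    rw [Nat.add_comm, Nat.add_mul_mod_self_right, Nat.mod_eq_of_lt hv]
  simp only [hlt, exists_true_left, hd, hm, decide_eq_true_eq, adj, hu, hv]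

theorem isOne_encode_bits (I : TSTInstance) (i : ℕ) :
    IsOne I.encode (I.n + 1 + I.n + I.n * I.n + i) ↔ IsOne I.k.bits i := by
  rw [encode_eq, isOne_append_right (by simp; omega)]

theorem drop_encode (I : TSTInstance) :
    I.encode.drop (I.n + 1 + I.n + I.n * I.n) = I.k.bits := by
  rw [encode_eq, List.drop_left' (by simp; omega)]

end TSTInstance

/-- The terminals of the instance with `n` vertices that `x` encodes. -/
def codedTerm (x : List Bool) (n v : ℕ) : Prop := v < n ∧ IsOne x (n + 1 + v)

/-- Adjacency in the instance with `n` vertices that `x` encodes. -/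
def codedAdj (x : List Bool) (n u v : ℕ) : Prop :=
  u < n ∧ v < n ∧ IsOne x (n + 1 + n + (u * n + v))

/-- The number of bits of the instance with `n` vertices without the bits of `k`. -/
def headerLength (n : ℕ) : ℕ := n + 1 + n + n * n

/-- The number `k` of the instance with `n` vertices that `x` encodes. -/
def codedK (x : List Bool) (n : ℕ) : ℕ := suffixValue x (x.length - headerLength n)

/-- `x` encodes an instance with `n` vertices. -/
def IsCode (x : List Bool) (n : ℕ) : Prop :=
  headerLength n < x.length ∧ IsOne x (x.length - 1) ∧
    (∀ u v, codedAdj x n u v → codedAdj x n v u) ∧ ∀ u, ¬ codedAdj x n u u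

namespace TSTInstance

theorem length_bits_pos (I : TSTInstance) : 0 < I.k.bits.length := by
  rw [List.length_pos_iff]
  intro h
  have := I.k_pos
  have h2 := Nat.digits_two_eq_bits I.k
  rw [h, List.map_nil, Nat.digits_eq_nil_iff_eq_zero] at h2
  omega

theorem headerLength_lt (I : TSTInstance) : headerLength I.n < I.encode.length := by
  have := I.length_bits_pos
  rw [length_encode, headerLength]; omega

theorem codedTerm_encode (I : TSTInstance) : codedTerm I.encode I.n = I.term := by
  ext v
  refine ⟨fun h => (I.isOne_encode_term h.1).1 h.2, fun h => ⟨h.1, (I.isOne_encode_term h.1).2 h⟩⟩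

theorem codedAdj_encode (I : TSTInstance) : codedAdj I.encode I.n = I.adj := by
  ext u v
  refine ⟨fun h => (I.isOne_encode_adj h.1 h.2.1).1 h.2.2,
    fun h => ⟨h.1, h.2.1, (I.isOne_encode_adj h.1 h.2.1).2 h⟩⟩

theorem codedK_encode (I : TSTInstance) : codedK I.encode I.n = I.k := by
  have h := I.headerLength_lt
  unfold codedK suffixValue
  rw [Nat.sub_sub_self h.le, headerLength, drop_encode, ← Nat.digits_two_eq_bits,
    Nat.ofDigits_digits]

theorem isCode_encode (I : TSTInstance) : IsCode I.encode I.n := by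
  have hb := I.length_bits_pos
  refine ⟨I.headerLength_lt, ?_, ?_, ?_⟩
  · have hl : I.encode.length - 1 = I.n + 1 + I.n + I.n * I.n + (I.k.bits.length - 1) := by
      rw [length_encode]; omega
    rw [hl, isOne_encode_bits, IsOne, ← List.getLast?_eq_getElem?]
    have hne : I.k.bits ≠ [] := List.ne_nil_of_length_pos hb
    have := Nat.getLast_digit_ne_zero 2 I.k_pos.ne'
    simp only [Nat.digits_two_eq_bits, List.getLast_map] at this
    rw [List.getLast?_eq_some_getLast hne]
    cases hc : I.k.bits.getLast hne
    · simp [hc] at this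
    · rfl
  · rw [codedAdj_encode]
    rintro u v ⟨hu, hv, h⟩
    exact ⟨hv, hu, h.symm⟩
  · rw [codedAdj_encode]
    rintro u ⟨_, _, h⟩
    exact h.ne rfl

end TSTInstance

/-- Since the last bit is `1`, the tail of `x` has no superfluous leading zeros and is therefore
exactly the bit list of its value, which is positive. Symmetry and irreflexivity make the matrix a
simple graph. The encoding of the resulting instance is compared with `x` bit by bit, separately in
each segment. -/
theorem IsCode.exists_encode_eq {x : List Bool} {n : ℕ} (h : IsCode x n)
    (h1 : ∀ i < n, IsOne x i) (h2 : ¬ IsOne x n) :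
    ∃ I : TSTInstance, I.encode = x ∧ I.n = n := by
  classical
  obtain ⟨hlen, hlast, hsymm, hirr⟩ := h
  set D := x.drop (headerLength n) with hD
  have hDlen : D.length = x.length - headerLength n := List.length_drop
  have hDne : D ≠ [] := List.ne_nil_of_length_pos (by omega)
  have hk : codedK x n = Nat.ofDigits 2 (D.map fun b => bif b then 1 else 0) := by
    unfold codedK suffixValue
    rw [Nat.sub_sub_self hlen.le]
  have hDlast : D.getLast hDne = true := by
    have : D.getLast? = some true := by
      rw [List.getLast?_eq_getElem?, hD, List.getElem?_drop, List.length_drop]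
      rw [show headerLength n + (x.length - headerLength n - 1) = x.length - 1 by omega]
      exact hlast
    rw [List.getLast?_eq_some_getLast hDne] at this
    exact Option.some.inj this
  have hdig : Nat.digits 2 (codedK x n) = D.map fun b => bif b then 1 else 0 := by
    rw [hk]
    apply Nat.digits_ofDigits 2 (by norm_num)
    · intro l hl
      obtain ⟨b, _, rfl⟩ := List.mem_map.1 hl
      cases b <;> simp
    · intro hne
      rw [List.getLast_map, hDlast]
      simp
  have hbits : (codedK x n).bits = D := by
    rw [Nat.digits_two_eq_bits] at hdig
    refine List.map_injective_iff.2 ?_ hdig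
    intro a b hab
    cases a <;> cases b <;> simp_all
  have hkpos : 0 < codedK x n := by
    rcases Nat.eq_zero_or_pos (codedK x n) with h0 | h0
    · rw [h0, Nat.zero_bits] at hbits
      exact absurd hbits.symm hDne
    · exact h0
  let I : TSTInstance :=
    { n := n
      G := { Adj := fun u v => codedAdj x n u v
             symm := ⟨fun u v h => hsymm u v h⟩
             loopless := ⟨fun u h => hirr u h⟩ }
      T := Finset.univ.filter fun v : Fin n => codedTerm x n v
      k := codedK x n
      k_pos := hkpos }
  have hterm : ∀ v, I.term v ↔ codedTerm x n v := by
    intro v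
    refine ⟨fun ⟨_, h⟩ => (Finset.mem_filter.1 h).2, fun h => ⟨h.1, ?_⟩⟩
    exact Finset.mem_filter.2 ⟨Finset.mem_univ _, h⟩
  have hadj : ∀ u v, I.adj u v ↔ codedAdj x n u v := by
    intro u v
    exact ⟨fun ⟨_, _, h⟩ => h, fun h => ⟨h.1, h.2.1, h⟩⟩
  have hxlen : I.encode.length = x.length := by
    rw [I.length_encode]
    change n + 1 + n + n * n + (codedK x n).bits.length = x.length
    rw [hbits, hDlen]
    unfold headerLength at *
    omega
  refine ⟨I, List.eq_of_isOne_iff hxlen fun i hi => ?_, rfl⟩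
  by_cases c1 : i < n
  · exact ⟨fun _ => h1 i c1, fun _ => I.isOne_encode_unary c1⟩
  by_cases c2 : i = n
  · subst c2
    exact ⟨fun h => absurd h I.not_isOne_encode_n, fun h => absurd h h2⟩
  by_cases c3 : i < n + 1 + n
  · obtain ⟨v, rfl⟩ : ∃ v, i = n + 1 + v := ⟨i - (n + 1), by omega⟩
    have hv : v < n := by omega
    refine (I.isOne_encode_term hv).trans ((hterm v).trans ?_)
    exact ⟨fun h => h.2, fun h => ⟨hv, h⟩⟩
  by_cases c4 : i < n + 1 + n + n * n
  · obtain ⟨w, rfl⟩ : ∃ w, i = n + 1 + n + w := ⟨i - (n + 1 + n), by omega⟩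
    have hw : w < n * n := by omega
    have hn : 0 < n := Nat.pos_of_ne_zero fun h => by simp [h] at hw
    have hu : w / n < n := Nat.div_lt_of_lt_mul hw
    have hv : w % n < n := Nat.mod_lt _ hn
    have hwd : w / n * n + w % n = w := by rw [Nat.mul_comm]; exact Nat.div_add_mod w n
    have e1 := I.isOne_encode_adj hu hv
    have e2 := hadj (w / n) (w % n)
    change IsOne I.encode (n + 1 + n + (w / n * n + w % n)) ↔ _ at e1
    rw [hwd] at e1
    refine e1.trans (e2.trans ?_)
    unfold codedAdj
    rw [hwd]
    exact ⟨fun h => h.2.2, fun h => ⟨hu, hv, h⟩⟩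
  · obtain ⟨w, rfl⟩ : ∃ w, i = n + 1 + n + n * n + w :=
      ⟨i - (n + 1 + n + n * n), by omega⟩
    refine (I.isOne_encode_bits w).trans ?_
    change IsOne (codedK x n).bits w ↔ _
    rw [hbits, hD]
    unfold IsOne
    rw [List.getElem?_drop]
    rfl

theorem IsCode.codedK_pos {x : List Bool} {n : ℕ} (h : IsCode x n) (h1 : ∀ i < n, IsOne x i)
    (h2 : ¬ IsOne x n) : 0 < codedK x n := by
  obtain ⟨I, rfl, rfl⟩ := h.exists_encode_eq h1 h2
  rw [I.codedK_encode]
  exact I.k_pos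

open Classical in
/-- The condition that the algorithm checks, for a string whose first `0` is at position `n`. -/
theorem mem_terminalSteinerTree_iff {x : List Bool} {n : ℕ} (h1 : ∀ i < n, IsOne x i)
    (h2 : ¬ IsOne x n) (p : ℕ) :
    (x, p) ∈ terminalSteinerTree ↔ IsCode x n ∧
      codedK x n + Nat.count (codedTerm x n) n = p ∧
      ((Nat.count (codedTerm x n) n = 2 ∧
          ∃ u v, codedTerm x n u ∧ codedTerm x n v ∧ codedAdj x n u v) ∨
        ∃ par : ℕ → ℕ, (∀ j, 1 ≤ j → j < p → par j < j ∧ par j < codedK x n) ∧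
          TreeHom (slot n (codedK x n) (codedTerm x n)) (codedAdj x n) par p) := by
  -- The first `0` of an encoding ends the unary part, so `x` determines the number of vertices.
  have key : ∀ I : TSTInstance, I.encode = x → I.n = n := by
    rintro I rfl
    rcases lt_trichotomy I.n n with h | h | h
    · exact absurd (h1 _ h) I.not_isOne_encode_n
    · exact h
    · exact absurd (I.isOne_encode_unary h) h2
  have main : ∀ I : TSTInstance, I.encode = x → ((I.param = p ∧ I.IsYes) ↔
      codedK x n + Nat.count (codedTerm x n) n = p ∧
      ((Nat.count (codedTerm x n) n = 2 ∧
          ∃ u v, codedTerm x n u ∧ codedTerm x n v ∧ codedAdj x n u v) ∨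
        ∃ par : ℕ → ℕ, (∀ j, 1 ≤ j → j < p → par j < j ∧ par j < codedK x n) ∧
          TreeHom (slot n (codedK x n) (codedTerm x n)) (codedAdj x n) par p)) := by
    intro I hI
    obtain rfl := key I hI
    subst hI
    have hcount := I.count_term
    rw [I.codedTerm_encode, I.codedAdj_encode, I.codedK_encode, hcount]
    refine and_congr_right ?_
    rintro rfl
    exact I.isYes_iff
  constructor
  · rintro ⟨I, hI, hp, hyes⟩
    refine ⟨?_, (main I hI).1 ⟨hp, hyes⟩⟩
    obtain rfl := key I hI
    rw [← show I.encode = x from hI]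
    exact I.isCode_encode
  · rintro ⟨hcode, h⟩
    obtain ⟨I, hI, -⟩ := hcode.exists_encode_eq h1 h2
    obtain ⟨hp, hyes⟩ := (main I hI).2 h
    exact ⟨I, hI, hp, hyes⟩

/-! ### A small imperative language on top of random access machines -/

namespace RAM

/-- The variables of the programs below, kept in the first registers. -/
inductive Var where
  | len | param | order | sq | termBase | adjBase | bitsBase | numT | budget | bad | ix | row | col
  | rowBase | colBase | ans | bound | tree | quot | node | parent | nodeBase | parentBase | flag
  | rank
  deriving DecidableEq

/-- The first register that is not used for a variable. -/
def base : ℕ := 32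

/-- The register of a variable. -/
def Var.idx (v : Var) : ℕ := v.ctorIdx

theorem Var.idx_lt (v : Var) : v.idx < base := by cases v <;> decide

theorem Var.idx_injective : Function.Injective Var.idx := fun _ _ h =>
  Function.LeftInverse.injective (g := Var.ofNat) Var.ofNat_ctorIdx h

/-- The values of the variables and the memory. -/
structure Env where
  reg : Var → ℕ
  mem : ℕ → ℕ

namespace Env

def set (σ : Env) (v : Var) (x : ℕ) : Env := { σ with reg := Function.update σ.reg v x }

def put (σ : Env) (a x : ℕ) : Env := { σ with mem := Function.update σ.mem a x }

@[simp] theorem reg_set (σ : Env) (v w : Var) (x : ℕ) :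
    (σ.set v x).reg w = if w = v then x else σ.reg w := by
  simp [set, Function.update_apply]

@[simp] theorem mem_set (σ : Env) (v : Var) (x : ℕ) : (σ.set v x).mem = σ.mem := rfl

@[simp] theorem reg_put (σ : Env) (a x : ℕ) : (σ.put a x).reg = σ.reg := rfl

@[simp] theorem mem_put (σ : Env) (a x b : ℕ) :
    (σ.put a x).mem b = if b = a then x else σ.mem b := by
  simp [put, Function.update_apply]

end Env

/-- `τ` differs from `σ` at most in the variables `ms` and in the memory. -/
def Frame (ms : List Var) (σ τ : Env) : Prop := ∀ w, w ∉ ms → τ.reg w = σ.reg w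

theorem Frame.refl (ms : List Var) (σ : Env) : Frame ms σ σ := fun _ _ => rfl

theorem Frame.set {ms : List Var} {σ τ : Env} (h : Frame ms σ τ) {v : Var} {x : ℕ} (hv : v ∈ ms) :
    Frame ms σ (τ.set v x) := by
  intro w hw
  have hne : w ≠ v := by rintro rfl; exact hw hv
  rw [Env.reg_set, if_neg hne, h w hw]

theorem Frame.trans {ms ms' : List Var} {σ τ ρ : Env} (h : Frame ms σ τ) (h' : Frame ms' τ ρ)
    (hms : ms' ⊆ ms) : Frame ms σ ρ :=
  fun w hw => (h' w fun hmem => hw (hms hmem)).trans (h w hw)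

/-- The state `s` of the machine realizes the environment `σ`. -/
def Realizes (s : State) (σ : Env) : Prop := s.mem = σ.mem ∧ ∀ v : Var, s.reg v.idx = σ.reg v

theorem Realizes.congr {s s' : State} {σ : Env} (h : Realizes s σ) (hm : s'.mem = s.mem)
    (hr : ∀ r < base, s'.reg r = s.reg r) : Realizes s' σ :=
  ⟨hm.trans h.1, fun v => (hr _ v.idx_lt).trans (h.2 v)⟩

theorem Realizes.set {s s' : State} {σ : Env} {v : Var} {x : ℕ} (h : Realizes s σ)
    (hm : s'.mem = s.mem) (hx : s'.reg v.idx = x)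
    (hr : ∀ r < base, r ≠ v.idx → s'.reg r = s.reg r) : Realizes s' (σ.set v x) := by
  refine ⟨hm.trans h.1, fun w => ?_⟩
  rw [Env.reg_set]
  split_ifs with hw
  · rw [hw, hx]
  · rw [hr _ w.idx_lt (fun e => hw (Var.idx_injective e)), h.2]

/-- Arithmetic expressions. -/
inductive Exp where
  | var (v : Var) : Exp
  | const (c : ℕ) : Exp
  | add (a b : Exp) : Exp
  | sub (a b : Exp) : Exp
  | load (a : Exp) : Exp

namespace Exp

/-- The value of an expression. -/
@[simp] def eval (σ : Env) : Exp → ℕ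
  | var v => σ.reg v
  | const c => c
  | add a b => a.eval σ + b.eval σ
  | sub a b => a.eval σ - b.eval σ
  | load a => σ.mem (a.eval σ)

/-- The number of steps for the evaluation of an expression. -/
@[simp] def cost : Exp → ℕ
  | var _ => 2
  | const _ => 1
  | add a b => a.cost + b.cost + 1
  | sub a b => a.cost + b.cost + 1
  | load a => a.cost + 1

/-- Evaluates an expression into register `d`. -/
def code : Exp → ℕ → Prog
  | var v, d => .seq (.const d 0) (.add d d v.idx)
  | const c, d => .const d c
  | add a b, d => .seq (.seq (a.code d) (b.code (d + 1))) (.add d d (d + 1))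
  | sub a b, d => .seq (.seq (a.code d) (b.code (d + 1))) (.sub d d (d + 1))
  | load a, d => .seq (a.code d) (.load d d)

/-- The registers from `d` on act as a stack: the first operand waits in `d` while the second is
evaluated at `d + 1`. Preserving everything below `d` protects both the operand and the variables.
-/
theorem runs_code (e : Exp) {σ : Env} : ∀ {d : ℕ} {s : State}, base ≤ d → Realizes s σ →
    ∃ s', Runs (e.code d) s s' e.cost ∧ s'.mem = s.mem ∧ s'.reg d = e.eval σ ∧
      ∀ r < d, s'.reg r = s.reg r := by
  induction e with
  | var v =>
    intro d s hd h
    refine ⟨_, .seq (.const _ _ _) (.add _ _ _ _), rfl, ?_, fun r hr => ?_⟩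
    · have := v.idx_lt
      simp [State.setReg, Function.update_of_ne (show v.idx ≠ d by omega), h.2]
    · simp [State.setReg, Function.update_of_ne hr.ne]
  | const c =>
    intro d s hd h
    refine ⟨_, .const _ _ _, rfl, by simp [State.setReg], fun r hr => ?_⟩
    simp [State.setReg, Function.update_of_ne hr.ne]
  | add a b iha ihb =>
    intro d s hd h
    obtain ⟨s₁, r₁, m₁, v₁, k₁⟩ := iha hd h
    obtain ⟨s₂, r₂, m₂, v₂, k₂⟩ := ihb (d := d + 1) (by omega)
      (h.congr m₁ fun r hr => k₁ r (by omega))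
    refine ⟨_, .seq (.seq r₁ r₂) (.add _ _ _ _), m₂.trans m₁, ?_, fun r hr => ?_⟩
    · simp [State.setReg, v₂, k₂ d (by omega), v₁]
    · simp [State.setReg, Function.update_of_ne hr.ne, k₂ r (by omega), k₁ r hr]
  | sub a b iha ihb =>
    intro d s hd h
    obtain ⟨s₁, r₁, m₁, v₁, k₁⟩ := iha hd h
    obtain ⟨s₂, r₂, m₂, v₂, k₂⟩ := ihb (d := d + 1) (by omega)
      (h.congr m₁ fun r hr => k₁ r (by omega))
    refine ⟨_, .seq (.seq r₁ r₂) (.sub _ _ _ _), m₂.trans m₁, ?_, fun r hr => ?_⟩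
    · simp [State.setReg, v₂, k₂ d (by omega), v₁]
    · simp [State.setReg, Function.update_of_ne hr.ne, k₂ r (by omega), k₁ r hr]
  | load a iha =>
    intro d s hd h
    obtain ⟨s₁, r₁, m₁, v₁, k₁⟩ := iha hd h
    refine ⟨_, .seq r₁ (.load _ _ _), m₁, ?_, fun r hr => ?_⟩
    · simp [State.setReg, v₁, m₁, h.1]
    · simp [State.setReg, Function.update_of_ne hr.ne, k₁ r hr]

/-- `1` if both values are equal, and `0` otherwise. -/
def eq (a b : Exp) : Exp := .sub (.const 1) (.add (.sub a b) (.sub b a))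

/-- `1` if both values are nonzero, and `0` otherwise. -/
def and (a b : Exp) : Exp := .sub (.const 1) (.add (.sub (.const 1) a) (.sub (.const 1) b))

theorem eval_eq_eq_zero {σ : Env} {a b : Exp} : (eq a b).eval σ = 0 ↔ a.eval σ ≠ b.eval σ := by
  simp only [eq, eval]; omega

theorem eval_and_eq_zero {σ : Env} {a b : Exp} :
    (and a b).eval σ = 0 ↔ ¬ (a.eval σ ≠ 0 ∧ b.eval σ ≠ 0) := by
  simp only [and, eval]; omega

@[simp] theorem cost_eq {a b : Exp} : (eq a b).cost = 2 * (a.cost + b.cost) + 5 := by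
  simp only [eq, cost]; omega

@[simp] theorem cost_and {a b : Exp} : (and a b).cost = a.cost + b.cost + 7 := by
  simp only [and, cost]; omega

end Exp

/-- Total correctness with a time bound: from `σ`, the program halts after at most `t` steps in an
environment that satisfies `Q`. -/
def Tot (p : Prog) (σ : Env) (t : ℕ) (Q : Env → Prop) : Prop :=
  ∀ s, Realizes s σ → ∃ s' σ' t', Runs p s s' t' ∧ t' ≤ t ∧ Realizes s' σ' ∧ Q σ'

theorem Tot.mono {p : Prog} {σ : Env} {t t' : ℕ} {Q Q' : Env → Prop} (h : Tot p σ t Q)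
    (ht : t ≤ t') (hQ : ∀ τ, Q τ → Q' τ) : Tot p σ t' Q' := by
  intro s hs
  obtain ⟨s', σ', t₁, hr, hle, hs', hq⟩ := h s hs
  exact ⟨s', σ', t₁, hr, hle.trans ht, hs', hQ _ hq⟩

theorem Tot.weaken {p : Prog} {σ : Env} {t t' : ℕ} {Q : Env → Prop} (h : Tot p σ t Q)
    (ht : t ≤ t') : Tot p σ t' Q := h.mono ht fun _ => id

theorem Tot.skip {σ : Env} {Q : Env → Prop} (h : Q σ) : Tot .skip σ 1 Q :=
  fun s hs => ⟨s, σ, 1, .skip s, le_rfl, hs, h⟩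

theorem Tot.seq {p q : Prog} {σ : Env} {t t' : ℕ} {Q : Env → Prop}
    (h : Tot p σ t fun τ => Tot q τ t' Q) : Tot (.seq p q) σ (t + t') Q := by
  intro s hs
  obtain ⟨s₁, σ₁, t₁, r₁, l₁, hs₁, h₁⟩ := h s hs
  obtain ⟨s₂, σ₂, t₂, r₂, l₂, hs₂, h₂⟩ := h₁ s₁ hs₁
  exact ⟨s₂, σ₂, _, .seq r₁ r₂, Nat.add_le_add l₁ l₂, hs₂, h₂⟩

/-- `v := e` -/
def assign (v : Var) (e : Exp) : Prog :=
  .seq (e.code base) (.seq (.const v.idx 0) (.add v.idx v.idx base))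

theorem Tot.assign {v : Var} {e : Exp} {σ : Env} {Q : Env → Prop}
    (h : Q (σ.set v (e.eval σ))) : Tot (assign v e) σ (e.cost + 2) Q := by
  intro s hs
  obtain ⟨s₁, r₁, m₁, v₁, k₁⟩ := e.runs_code le_rfl hs
  have hv := v.idx_lt
  refine ⟨_, _, _, .seq r₁ (.seq (.const _ _ _) (.add _ _ _ _)), le_rfl,
    hs.set m₁ ?_ (fun r hr hne => ?_), h⟩
  · simp [State.setReg, Function.update_of_ne hv.ne', v₁]
  · simp [State.setReg, Function.update_of_ne hne, k₁ r hr]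

/-- `mem a := e` -/
def assignMem (a e : Exp) : Prog :=
  .seq (.seq (a.code base) (e.code (base + 1))) (.store base (base + 1))

theorem Tot.assignMem {a e : Exp} {σ : Env} {Q : Env → Prop}
    (h : Q (σ.put (a.eval σ) (e.eval σ))) : Tot (assignMem a e) σ (a.cost + e.cost + 1) Q := by
  intro s hs
  obtain ⟨s₁, r₁, m₁, v₁, k₁⟩ := a.runs_code le_rfl hs
  have hs₁ := hs.congr m₁ k₁
  obtain ⟨s₂, r₂, m₂, v₂, k₂⟩ := e.runs_code (Nat.le_succ base) hs₁
  have hs₂ := hs₁.congr m₂ fun r hr => k₂ r (Nat.lt_succ_of_lt hr)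
  refine ⟨_, σ.put (a.eval σ) (e.eval σ), _, .seq (.seq r₁ r₂) (.store _ _ _), le_rfl,
    ⟨?_, fun v => hs₂.2 v⟩, h⟩
  simp only [State.setMem, Env.put, v₂, k₂ base (Nat.lt_succ_self _), v₁, hs₂.1]

/-- `if e then p else q` -/
def ite (e : Exp) (p q : Prog) : Prog := .seq (e.code base) (.cond base p q)

theorem Tot.ite {e : Exp} {p q : Prog} {σ : Env} {t : ℕ} {Q : Env → Prop}
    (hp : e.eval σ ≠ 0 → Tot p σ t Q) (hq : e.eval σ = 0 → Tot q σ t Q) :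
    Tot (ite e p q) σ (e.cost + (t + 1)) Q := by
  intro s hs
  obtain ⟨s₁, r₁, m₁, v₁, k₁⟩ := e.runs_code le_rfl hs
  have hs₁ := hs.congr m₁ k₁
  by_cases h0 : e.eval σ = 0
  · obtain ⟨s', σ', t', hr, hle, hs', hQ⟩ := hq h0 s₁ hs₁
    exact ⟨s', σ', _, .seq r₁ (.condFalse (v₁.trans h0) hr), by omega, hs', hQ⟩
  · obtain ⟨s', σ', t', hr, hle, hs', hQ⟩ := hp h0 s₁ hs₁
    exact ⟨s', σ', _, .seq r₁ (.condTrue (by rwa [v₁]) hr), by omega, hs', hQ⟩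

/-- `while e do p` -/
def whileLoop (e : Exp) (p : Prog) : Prog :=
  .seq (e.code base) (.loop base (.seq p (e.code base)))

/-- The index `N` of the invariant is a bound on the remaining rounds. It drops strictly in each
round, which gives termination and the time bound together. -/
theorem Tot.whileLoop {e : Exp} {p : Prog} {t : ℕ} {I : ℕ → Env → Prop}
    (hstep : ∀ N τ, I N τ → e.eval τ ≠ 0 → ∃ M < N, Tot p τ t (I M)) :
    ∀ {N : ℕ} {σ : Env}, I N σ →
    Tot (whileLoop e p) σ (N * (t + e.cost + 1) + (e.cost + 1))
      (fun τ => e.eval τ = 0 ∧ ∃ M ≤ N, I M τ) := by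
  -- The machine loop tests register `base`, which must already hold the value of `e`; it is
  -- recomputed at the end of each round.
  have key : ∀ N σ s, I N σ → Realizes s σ → s.reg base = e.eval σ →
      ∃ s' σ' t', Runs (.loop base (.seq p (e.code base))) s s' t' ∧
        t' ≤ N * (t + e.cost + 1) + 1 ∧ Realizes s' σ' ∧
        e.eval σ' = 0 ∧ ∃ M ≤ N, I M σ' := by
    intro N
    induction N using Nat.strong_induction_on with
    | _ N ih =>
      intro σ s hI hs hv
      by_cases h0 : e.eval σ = 0
      · exact ⟨s, σ, 1, .loopDone (hv.trans h0), by omega, hs, h0, N, le_rfl, hI⟩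
      · obtain ⟨M, hM, hT⟩ := hstep N σ hI h0
        obtain ⟨s₁, σ₁, t₁, r₁, l₁, hs₁, hI₁⟩ := hT s hs
        obtain ⟨s₂, r₂, m₂, v₂, k₂⟩ := e.runs_code le_rfl hs₁
        obtain ⟨s₃, σ₃, t₃, r₃, l₃, hs₃, h₃, M', hM', hI₃⟩ :=
          ih M hM σ₁ s₂ hI₁ (hs₁.congr m₂ k₂) v₂
        refine ⟨s₃, σ₃, _, .loopStep (by rwa [hv]) (.seq r₁ r₂) r₃, ?_, hs₃, h₃, M', by omega, hI₃⟩
        have : (M + 1) * (t + e.cost + 1) ≤ N * (t + e.cost + 1) := Nat.mul_le_mul_right _ hM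
        rw [Nat.add_mul] at this
        omega
  intro N σ hI s hs
  obtain ⟨s₁, r₁, m₁, v₁, k₁⟩ := e.runs_code le_rfl hs
  obtain ⟨s₂, σ₂, t₂, r₂, l₂, hs₂, h₂⟩ := key N σ s₁ hI (hs.congr m₁ k₁) v₁
  exact ⟨s₂, σ₂, _, .seq r₁ r₂, by omega, hs₂, h₂⟩

/-- `for i < e do p` -/
def forLoop (i : Var) (e : Exp) (p : Prog) : Prog :=
  .seq (assign i (.const 0))
    (whileLoop (.sub e (.var i)) (.seq p (assign i (.add (.var i) (.const 1)))))

/-- The rule for loops with a counter; `I j` is the invariant before round `j`. -/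
theorem Tot.forLoop {i : Var} {e : Exp} {p : Prog} {σ : Env} {t N : ℕ} (I : ℕ → Env → Prop)
    (hinv : ∀ j τ, I j τ → τ.reg i = j ∧ e.eval τ = N)
    (h0 : I 0 (σ.set i 0))
    (hstep : ∀ j < N, ∀ τ, I j τ → Tot p τ t fun τ' => τ'.reg i = j ∧ I (j + 1) (τ'.set i (j + 1))) :
    Tot (forLoop i e p) σ ((N + 1) * (t + e.cost + 16)) (I N) := by
  -- The remaining rounds are `N - j`. Incrementing the counter takes 4 steps of evaluation and 2 of
  -- storing, hence `t + 6`.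
  have hw := Tot.whileLoop (e := .sub e (.var i))
    (p := .seq p (RAM.assign i (.add (.var i) (.const 1)))) (t := t + 6)
    (I := fun M τ => ∃ j, j + M = N ∧ I j τ) (by
      rintro M τ ⟨j, hj, hI⟩ hne
      obtain ⟨h1, h2⟩ := hinv j τ hI
      simp only [Exp.eval, h1, h2] at hne
      refine ⟨M - 1, by omega, Tot.seq ((hstep j (by omega) τ hI).mono le_rfl ?_)⟩
      rintro τ' ⟨h3, h4⟩
      refine Tot.assign ⟨j + 1, by omega, ?_⟩
      simpa [h3] using h4) (N := N) (σ := σ.set i 0) ⟨0, by omega, h0⟩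
  refine (Tot.seq (Tot.assign (hw.mono le_rfl ?_))).weaken ?_
  · rintro τ ⟨h1, M, hM, j, hj, hI⟩
    obtain ⟨h2, h3⟩ := hinv j τ hI
    simp only [Exp.eval, h2, h3] at h1
    obtain rfl : j = N := by omega
    exact hI
  · simp only [Exp.cost]
    have : N * (t + 6 + (e.cost + 2 + 1) + 1) ≤ N * (t + e.cost + 16) :=
      Nat.mul_le_mul_left _ (by omega)
    rw [Nat.add_mul]
    omega

/-- `v := a * b`, by repeated addition -/
def assignMul (v : Var) (a b : Exp) : Prog :=
  .seq (.seq (.seq (a.code base) (b.code (base + 1)))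
    (.seq (.const (base + 2) 0) (.const (base + 3) 1)))
    (.seq (.loop base (.seq (.add (base + 2) (base + 2) (base + 1)) (.sub base base (base + 3))))
      (.seq (.const v.idx 0) (.add v.idx v.idx (base + 2))))

/-- Register `base` counts down, `base + 1` is the summand, `base + 2` the accumulator and `base +
3` the constant one. A round costs two instructions and a test. -/
theorem runs_mul_loop (N : ℕ) : ∀ s : State, s.reg base = N → s.reg (base + 3) = 1 →
    ∃ s', Runs (.loop base (.seq (.add (base + 2) (base + 2) (base + 1))
        (.sub base base (base + 3)))) s s' (3 * N + 1) ∧ s'.mem = s.mem ∧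
      s'.reg (base + 2) = s.reg (base + 2) + N * s.reg (base + 1) ∧
      ∀ r < base, s'.reg r = s.reg r := by
  induction N with
  | zero =>
    intro s h _
    exact ⟨s, .loopDone h, rfl, by simp, fun _ _ => rfl⟩
  | succ N ih =>
    intro s h h3
    obtain ⟨s', r', m', v', k'⟩ := ih (((s.setReg (base + 2) (s.reg (base + 2) + s.reg (base + 1))
      )).setReg base (s.reg base - s.reg (base + 3))) (by simp [State.setReg, h, h3])
      (by simp [State.setReg, h3])
    refine ⟨s', ?_, m', ?_, fun r hr => ?_⟩
    · have := Runs.loopStep (a := base) (by omega)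
        (.seq (.add (base + 2) (base + 2) (base + 1) s) (.sub base base (base + 3) _))
        (by simpa [State.setReg] using r')
      convert this using 1
      ring
    · rw [v']
      simp [State.setReg]
      ring
    · rw [k' r hr]
      simp [State.setReg, Function.update_of_ne hr.ne,
        Function.update_of_ne (show r ≠ base + 2 by omega)]

theorem Tot.assignMul {v : Var} {a b : Exp} {σ : Env} {N : ℕ} {Q : Env → Prop}
    (hN : a.eval σ ≤ N) (h : Q (σ.set v (a.eval σ * b.eval σ))) :
    Tot (assignMul v a b) σ ((N + 1) * (a.cost + b.cost + 5)) Q := by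
  intro s hs
  obtain ⟨s₁, r₁, m₁, v₁, k₁⟩ := a.runs_code le_rfl hs
  have hs₁ := hs.congr m₁ k₁
  obtain ⟨s₂, r₂, m₂, v₂, k₂⟩ := b.runs_code (Nat.le_succ base) hs₁
  let s₃ := (s₂.setReg (base + 2) 0).setReg (base + 3) 1
  obtain ⟨s₄, r₄, m₄, v₄, k₄⟩ := runs_mul_loop (a.eval σ) s₃
    (by simp [s₃, State.setReg, k₂ base (Nat.lt_succ_self _), v₁]) (by simp [s₃, State.setReg])
  have hv := v.idx_lt
  refine ⟨_, _, _, .seq (.seq (.seq r₁ r₂) (.seq (.const _ _ _) (.const _ _ _)))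
    (.seq r₄ (.seq (.const _ _ _) (.add _ _ _ _))), ?_, hs.set ?_ ?_ (fun r hr hne => ?_), h⟩
  · have : (a.eval σ) * (a.cost + b.cost + 5) ≤ N * (a.cost + b.cost + 5) :=
      Nat.mul_le_mul_right _ hN
    have : a.eval σ * 3 ≤ a.eval σ * (a.cost + b.cost + 5) := Nat.mul_le_mul_left _ (by omega)
    rw [Nat.add_mul]
    omega
  · exact m₄.trans (m₂.trans m₁)
  · simp [State.setReg, Function.update_of_ne (show base + 2 ≠ v.idx by omega), v₄, s₃, v₂]
  · have hr' : ∀ x, r ≠ base + x := fun x => by omega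
    simp [State.setReg, Function.update_of_ne hne, k₄ r hr, s₃, Function.update_of_ne (hr' _),
      k₂ r (by omega), k₁ r hr]

/-- `v := a / b; w := a % b`, by repeated subtraction -/
def assignDivMod (v w : Var) (a b : Exp) : Prog :=
  .seq (.seq (.seq (a.code base) (b.code (base + 1)))
    (.seq (.const (base + 2) 0) (.seq (.const (base + 3) 1)
      (.seq (.add (base + 4) base (base + 3)) (.sub (base + 4) (base + 4) (base + 1))))))
    (.seq (.loop (base + 4)
      (.seq (.seq (.sub base base (base + 1)) (.add (base + 2) (base + 2) (base + 3)))
        (.seq (.add (base + 4) base (base + 3)) (.sub (base + 4) (base + 4) (base + 1)))))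
      (.seq (.seq (.const v.idx 0) (.add v.idx v.idx (base + 2)))
        (.seq (.const w.idx 0) (.add w.idx w.idx base))))

/-- Register `base` holds the remainder, `base + 2` the quotient, and `base + 4` the test value `N +
1 - b`, which is nonzero iff `b` can still be subtracted. Each round lowers `N` by `b ≥ 1`. -/
theorem runs_divMod_loop (b : ℕ) (hb : 0 < b) (N : ℕ) : ∀ s : State, s.reg base = N →
    s.reg (base + 1) = b → s.reg (base + 3) = 1 → s.reg (base + 4) = N + 1 - b →
    ∃ s' t', t' ≤ 5 * N + 1 ∧ Runs (.loop (base + 4)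
      (.seq (.seq (.sub base base (base + 1)) (.add (base + 2) (base + 2) (base + 3)))
        (.seq (.add (base + 4) base (base + 3)) (.sub (base + 4) (base + 4) (base + 1))))) s s' t' ∧
      s'.mem = s.mem ∧ s'.reg (base + 2) = s.reg (base + 2) + N / b ∧ s'.reg base = N % b ∧
      ∀ r < base, s'.reg r = s.reg r := by
  induction N using Nat.strong_induction_on with
  | _ N ih =>
    intro s h h1 h3 h4
    by_cases hlt : N < b
    · exact ⟨s, 1, by omega, .loopDone (by omega), rfl, by simp [Nat.div_eq_of_lt hlt],
        by rw [h, Nat.mod_eq_of_lt hlt], fun _ _ => rfl⟩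
    · let s₁ := (((s.setReg base (N - b)).setReg (base + 2) (s.reg (base + 2) + 1)).setReg
        (base + 4) (N - b + 1)).setReg (base + 4) (N - b + 1 - b)
      obtain ⟨s', t', l', r', m', v', w', k'⟩ := ih (N - b) (by omega) s₁
        (by simp [s₁, State.setReg]) (by simp [s₁, State.setReg, h1])
        (by simp [s₁, State.setReg, h3]) (by simp [s₁, State.setReg])
      refine ⟨s', _, ?_, .loopStep (by omega) (.seq (.seq (.sub _ _ _ s) (.add _ _ _ _))
        (.seq (.add _ _ _ _) (.sub _ _ _ _))) (?_ : Runs _ _ s' t'), m', ?_, ?_, fun r hr => ?_⟩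
      · omega
      · simpa [s₁, State.setReg, h, h1, h3] using r'
      · rw [v', Nat.div_eq_sub_div hb (by omega : b ≤ N)]
        simp [s₁, State.setReg]
        ring
      · rw [w', ← Nat.mod_eq_sub_mod (by omega)]
      · rw [k' r hr]
        have hr' : ∀ x, r ≠ base + x := fun x => by omega
        simp [s₁, State.setReg, Function.update_of_ne hr.ne, Function.update_of_ne (hr' _)]

theorem Tot.assignDivMod {v w : Var} (hvw : v ≠ w) {a b : Exp} {σ : Env} {N : ℕ} {Q : Env → Prop}
    (hb : 0 < b.eval σ) (hN : a.eval σ ≤ N)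
    (h : Q ((σ.set v (a.eval σ / b.eval σ)).set w (a.eval σ % b.eval σ))) :
    Tot (assignDivMod v w a b) σ ((N + 1) * (a.cost + b.cost + 9)) Q := by
  intro s hs
  obtain ⟨s₁, r₁, m₁, v₁, k₁⟩ := a.runs_code le_rfl hs
  have hs₁ := hs.congr m₁ k₁
  obtain ⟨s₂, r₂, m₂, v₂, k₂⟩ := b.runs_code (Nat.le_succ base) hs₁
  have hs₂ := hs₁.congr m₂ fun r hr => k₂ r (by omega)
  have hk₂ := k₂ base (Nat.lt_succ_self _)
  let s₃ := (((s₂.setReg (base + 2) 0).setReg (base + 3) 1).setReg (base + 4)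
    (a.eval σ + 1)).setReg (base + 4) (a.eval σ + 1 - b.eval σ)
  obtain ⟨s₄, t₄, l₄, r₄, m₄, v₄, w₄, k₄⟩ := runs_divMod_loop (b.eval σ) hb (a.eval σ) s₃
    (by simp [s₃, State.setReg, hk₂, v₁]) (by simp [s₃, State.setReg, v₂])
    (by simp [s₃, State.setReg]) (by simp [s₃, State.setReg])
  have hv := v.idx_lt
  have hw := w.idx_lt
  have hne : v.idx ≠ w.idx := fun e => hvw (Var.idx_injective e)
  have hs₄ : Realizes s₄ σ := by
    refine hs₂.congr m₄ fun r hr => ?_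
    have hr' : ∀ x, r ≠ base + x := fun x => by omega
    simp [k₄ r hr, s₃, State.setReg, Function.update_of_ne (hr' _)]
  let s₅ := s₄.setReg v.idx (a.eval σ / b.eval σ)
  have hs₅ : Realizes s₅ (σ.set v (a.eval σ / b.eval σ)) :=
    hs₄.set rfl (by simp [s₅, State.setReg])
      fun r _ hr => by simp [s₅, State.setReg, Function.update_of_ne hr]
  let s₆ := s₅.setReg w.idx (a.eval σ % b.eval σ)
  have hs₆ : Realizes s₆ ((σ.set v (a.eval σ / b.eval σ)).set w (a.eval σ % b.eval σ)) :=
    hs₅.set rfl (by simp [s₆, State.setReg])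
      fun r _ hr => by simp [s₆, State.setReg, Function.update_of_ne hr]
  have r₃ : Runs (.seq (.const (base + 2) 0) (.seq (.const (base + 3) 1)
      (.seq (.add (base + 4) base (base + 3)) (.sub (base + 4) (base + 4) (base + 1))))) s₂ s₃ 4 := by
    have := Runs.seq (.const (base + 2) 0 s₂) (.seq (.const (base + 3) 1 _)
      (.seq (.add (base + 4) base (base + 3) _) (.sub (base + 4) (base + 4) (base + 1) _)))
    simpa [State.setReg, s₃, hk₂, v₁, v₂] using this
  have r₆ : Runs (.seq (.seq (.const v.idx 0) (.add v.idx v.idx (base + 2)))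
        (.seq (.const w.idx 0) (.add w.idx w.idx base))) s₄ s₆ 4 := by
    have := Runs.seq (.seq (.const v.idx 0 s₄) (.add v.idx v.idx (base + 2) _))
        (.seq (.const w.idx 0 _) (.add w.idx w.idx base _))
    simpa [State.setReg, s₅, s₆, v₄, w₄, Function.update_of_ne (show base + 2 ≠ v.idx by omega),
      Function.update_of_ne (show base ≠ v.idx by omega),
      Function.update_of_ne (show base ≠ w.idx by omega), s₃] using this
  refine ⟨s₆, _, _, .seq (.seq (.seq r₁ r₂) r₃) (.seq r₄ r₆), ?_, hs₆, h⟩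
  have : (a.eval σ) * (a.cost + b.cost + 9) ≤ N * (a.cost + b.cost + 9) :=
    Nat.mul_le_mul_right _ hN
  have : a.eval σ * 5 ≤ a.eval σ * (a.cost + b.cost + 9) := Nat.mul_le_mul_left _ (by omega)
  rw [Nat.add_mul]
  omega

end RAM

/-! ### Reading and validating the input -/

namespace RAM

open Exp in
/-- Finds the number of vertices and the positions of the parts of the input. -/
def readHeader : Prog :=
  .seq (.seq (assign .order (const 0))
    (whileLoop (load (var .order)) (assign .order (add (var .order) (const 1)))))
  (.seq (assignMul .sq (var .order) (var .order))
  (.seq (assign .termBase (add (var .order) (const 1)))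
  (.seq (assign .adjBase (add (var .termBase) (var .order)))
    (assign .bitsBase (add (var .adjBase) (var .sq))))))

open Exp in
/-- Counts the terminals. -/
def countTerminals : Prog :=
  .seq (assign .numT (const 0))
    (forLoop .ix (var .order)
      (assign .numT (add (var .numT) (load (add (var .termBase) (var .ix))))))

open Exp in
/-- Reads the number `k`. -/
def readBudget : Prog :=
  .seq (assign .budget (const 0))
    (forLoop .ix (sub (var .len) (var .bitsBase))
      (assign .budget (add (add (var .budget) (var .budget))
        (load (sub (var .len) (add (var .ix) (const 1)))))))

open Exp in
/-- Checks that the input encodes an instance with the given parameter. -/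
def validate : Prog :=
  .seq (assign .bad (add (add (sub (const 1) (sub (var .len) (var .bitsBase)))
      (sub (const 1) (load (sub (var .len) (const 1)))))
    (add (sub (add (var .budget) (var .numT)) (var .param))
      (sub (var .param) (add (var .budget) (var .numT))))))
  (forLoop .row (var .order)
    (.seq (assignMul .rowBase (var .row) (var .order))
    (.seq (assign .rowBase (add (var .adjBase) (var .rowBase)))
    (.seq (forLoop .col (var .order)
      (.seq (assignMul .colBase (var .col) (var .order))
      (.seq (assign .colBase (add (var .adjBase) (var .colBase)))
        (assign .bad (add (var .bad) (sub (load (add (var .rowBase) (var .col)))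
          (load (add (var .colBase) (var .row)))))))))
      (assign .bad (add (var .bad) (load (add (var .rowBase) (var .row)))))))))

/-- The bits of the input as numbers. -/
def bit (x : List Bool) (i : ℕ) : ℕ := if x[i]? = some true then 1 else 0

theorem bit_eq_zero {x : List Bool} {i : ℕ} : bit x i = 0 ↔ ¬ IsOne x i := by
  unfold bit IsOne; split_ifs with h <;> simp [h]

theorem bit_le_one (x : List Bool) (i : ℕ) : bit x i ≤ 1 := by
  unfold bit; split_ifs <;> simp

theorem tot_readHeader {x : List Bool} {σ : Env} (hlen : σ.reg .len = x.length)
    (hmem : σ.mem = bit x) :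
    Tot readHeader σ (100 * (x.length + 1)) fun τ =>
      ∃ n ≤ x.length, (∀ i < n, IsOne x i) ∧ ¬ IsOne x n ∧ τ.mem = bit x ∧
        τ.reg .order = n ∧ τ.reg .termBase = n + 1 ∧ τ.reg .adjBase = n + 1 + n ∧
        τ.reg .bitsBase = headerLength n ∧
        Frame [.order, .sq, .termBase, .adjBase, .bitsBase] σ τ := by
  apply Tot.weaken
  · apply Tot.seq
    apply Tot.seq
    apply Tot.assign
    -- The scan stops at position `|x|` at the latest, since memory behind the input is zero.
    refine (Tot.whileLoop (t := 6) (N := x.length)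
      (I := fun N τ => ∃ n, n + N = x.length ∧ (∀ i < n, IsOne x i) ∧ τ.mem = bit x ∧
        τ.reg .order = n ∧ Frame [.order] σ τ) ?_ ?_).mono le_rfl ?_
    · rintro N τ ⟨n, hn, h1, hm, ho, hF⟩ hne
      simp only [Exp.eval, hm, ho, ne_eq, bit_eq_zero, not_not] at hne
      have hlt := IsOne.lt_length hne
      refine ⟨N - 1, by omega, Tot.assign ⟨n + 1, by omega, fun i hi => ?_, hm, ?_, ?_⟩⟩
      · rcases Nat.lt_succ_iff_lt_or_eq.1 hi with h | rfl
        · exact h1 i h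
        · exact hne
      · simp [ho]
      · exact hF.set (by simp)
    · exact ⟨0, by omega, by simp, hmem, by simp, (Frame.refl _ _).set (by simp)⟩
    · rintro τ ⟨h0, M, hM, n, hn, h1, hm, ho, hF⟩
      simp only [Exp.eval, hm, ho, bit_eq_zero] at h0
      apply Tot.seq
      apply Tot.assignMul (N := x.length) (by simp [ho]; omega)
      apply Tot.seq
      apply Tot.assign
      apply Tot.seq
      apply Tot.assign
      apply Tot.assign
      refine ⟨n, by omega, h1, h0, hm, by simp [ho], by simp [ho], by simp [ho],
        by simp [ho, headerLength], ?_⟩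
      exact ((((Frame.trans (Frame.refl _ _) hF (by simp)).set (by simp)).set (by simp)).set
        (by simp)).set (by simp)
  · simp only [Exp.cost]; omega

open Classical in
theorem tot_countTerminals {x : List Bool} {n : ℕ} {σ : Env} (hmem : σ.mem = bit x)
    (ho : σ.reg .order = n) (ht : σ.reg .termBase = n + 1) :
    Tot countTerminals σ (100 * (n + 1)) fun τ =>
      τ.reg .numT = Nat.count (codedTerm x n) n ∧ τ.mem = bit x ∧ Frame [.ix, .numT] σ τ := by
  apply Tot.weaken
  · apply Tot.seq
    apply Tot.assign
    refine (Tot.forLoop (t := 20) (N := n) (fun j τ => τ.reg .ix = j ∧ j ≤ n ∧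
      τ.reg .numT = Nat.count (codedTerm x n) j ∧ τ.mem = bit x ∧ Frame [.ix, .numT] σ τ)
      ?_ ?_ ?_).mono le_rfl ?_
    · rintro j τ ⟨hj, -, -, -, hF⟩
      exact ⟨hj, by simp [hF .order (by simp), ho]⟩
    · exact ⟨by simp, by simp, by simp, hmem, ((Frame.refl _ _).set (by simp)).set (by simp)⟩
    · rintro j hj τ ⟨hi, -, hc, hm, hF⟩
      apply Tot.weaken
      · apply Tot.assign
        refine ⟨by simp [hi], by simp, hj, ?_, hm, (hF.set (by simp)).set (by simp)⟩
        simp only [Env.reg_set, Exp.eval, hc, hm, hi, hF .termBase (by simp), ht, Nat.count_succ,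
          codedTerm, hj, true_and, bit, IsOne]
        simp
      · simp
    · rintro τ ⟨-, -, h⟩
      exact h
  · simp only [Exp.cost]; omega

theorem tot_readBudget {x : List Bool} {n : ℕ} {σ : Env} (hmem : σ.mem = bit x)
    (hlen : σ.reg .len = x.length) (hb : σ.reg .bitsBase = headerLength n) :
    Tot readBudget σ (100 * (x.length + 1)) fun τ =>
      τ.reg .budget = codedK x n ∧ τ.mem = bit x ∧ Frame [.ix, .budget] σ τ := by
  apply Tot.weaken
  · apply Tot.seq
    apply Tot.assign
    refine (Tot.forLoop (t := 20) (N := x.length - headerLength n) (fun j τ => τ.reg .ix = j ∧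
      τ.reg .budget = suffixValue x j ∧ τ.mem = bit x ∧ Frame [.ix, .budget] σ τ)
      ?_ ?_ ?_).mono le_rfl ?_
    · rintro j τ ⟨hj, -, -, hF⟩
      exact ⟨hj, by simp [hF .len (by simp), hF .bitsBase (by simp), hb, hlen]⟩
    · exact ⟨by simp, by simp [suffixValue_zero], hmem,
        ((Frame.refl _ _).set (by simp)).set (by simp)⟩
    · rintro j hj τ ⟨hi, hc, hm, hF⟩
      apply Tot.weaken
      · apply Tot.assign
        refine ⟨by simp [hi], by simp, ?_, hm, (hF.set (by simp)).set (by simp)⟩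
        rw [suffixValue_succ x (by omega)]
        simp [hc, hm, hi, hF .len (by simp), hlen, bit, IsOne]
        congr
      · simp
    · rintro τ ⟨-, h⟩
      exact h
  · simp only [Exp.cost]
    omega

open Classical in
-- The variable `bad` is a sum of natural-number penalties, one for each violated condition, so it
-- vanishes iff all conditions hold.
theorem tot_validate {x : List Bool} {n p : ℕ} {σ : Env} (hmem : σ.mem = bit x)
    (hlen : σ.reg .len = x.length) (hp : σ.reg .param = p) (ho : σ.reg .order = n)
    (ha : σ.reg .adjBase = n + 1 + n) (hb : σ.reg .bitsBase = headerLength n)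
    (hT : σ.reg .numT = Nat.count (codedTerm x n) n) (hk : σ.reg .budget = codedK x n) :
    Tot validate σ (400 * (n + 1) ^ 3) fun τ =>
      (τ.reg .bad = 0 ↔ IsCode x n ∧ codedK x n + Nat.count (codedTerm x n) n = p) ∧
      τ.mem = bit x ∧ Frame [.bad, .row, .col, .rowBase, .colBase] σ τ := by
  set ms : List Var := [.bad, .row, .col, .rowBase, .colBase] with hms
  let P₀ : Prop := headerLength n < x.length ∧ IsOne x (x.length - 1) ∧
    codedK x n + Nat.count (codedTerm x n) n = p
  let P : ℕ → ℕ → Prop := fun u v => codedAdj x n u v → codedAdj x n v u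
  apply Tot.weaken
  · apply Tot.seq
    apply Tot.assign
    refine (Tot.forLoop (t := 200 * (n + 1) ^ 2) (N := n) (fun u τ => τ.reg .row = u ∧
      (τ.reg .bad = 0 ↔ P₀ ∧ ∀ u' < u, (∀ v < n, P u' v) ∧ ¬ codedAdj x n u' u') ∧
      τ.mem = bit x ∧ Frame ms σ τ) ?_ ?_ ?_).mono le_rfl ?_
    · rintro j τ ⟨hj, -, -, hF⟩
      exact ⟨hj, by simp [hF .order (by simp [hms]), ho]⟩
    · refine ⟨by simp, ?_, hmem, ((Frame.refl _ _).set (by simp [hms])).set (by simp [hms])⟩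
      have hbit := bit_eq_zero (x := x) (i := x.length - 1)
      have hle := bit_le_one x (x.length - 1)
      have : (1 - bit x (x.length - 1) = 0) ↔ IsOne x (x.length - 1) := by
        rw [← not_iff_not, ← hbit]; omega
      simp only [Env.reg_set, Exp.eval, hlen, hb, hmem, hT, hk, hp, Nat.add_eq_zero_iff, this,
        reduceCtorEq, if_false, if_true, P₀, Nat.not_lt_zero, IsEmpty.forall_iff, implies_true,
        and_true]
      constructor
      · rintro ⟨⟨h1, h2⟩, h3, h4⟩
        exact ⟨by omega, h2, by omega⟩
      · rintro ⟨h1, h2, h3⟩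
        exact ⟨⟨by omega, h2⟩, by omega, by omega⟩
    · rintro u hu τ ⟨hrow, hbad, hm, hF⟩
      apply Tot.weaken
      · apply Tot.seq
        apply Tot.assignMul (N := n) (by simp [hrow]; omega)
        apply Tot.seq
        apply Tot.assign
        apply Tot.seq
        refine (Tot.forLoop (t := 60 * (n + 1)) (N := n) (fun v τ' => τ'.reg .col = v ∧
          τ'.reg .row = u ∧ τ'.reg .rowBase = n + 1 + n + u * n ∧
          (τ'.reg .bad = 0 ↔ τ.reg .bad = 0 ∧ ∀ v' < v, P u v') ∧
          τ'.mem = bit x ∧ Frame ms σ τ') ?_ ?_ ?_).mono le_rfl ?_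
        · rintro j τ' ⟨hj, -, -, -, -, hF⟩
          exact ⟨hj, by simp [hF .order (by simp [hms]), ho]⟩
        · refine ⟨by simp, by simp [hrow], ?_, by simp, hm, ?_⟩
          · simp [hrow, hF .order (by simp [hms]), ho, hF .adjBase (by simp [hms]), ha]
          · exact ((hF.set (by simp [hms])).set (by simp [hms])).set (by simp [hms])
        · rintro v hv τ' ⟨hcol, hrow', hrb, hbad', hm', hF'⟩
          apply Tot.weaken
          · apply Tot.seq
            apply Tot.assignMul (N := n) (by simp [hcol]; omega)
            apply Tot.seq
            apply Tot.assign
            apply Tot.assign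
            refine ⟨by simp [hcol], by simp, by simp [hrow'], by simp [hrb], ?_, hm', ?_⟩
            -- For bits, a truncated difference is zero iff the first bit implies the second.
            · have hP : P u v ↔ bit x (n + 1 + n + u * n + v) - bit x (n + 1 + n + v * n + u) = 0 := by
                have h1 := bit_eq_zero (x := x) (i := n + 1 + n + u * n + v)
                have h2 := bit_eq_zero (x := x) (i := n + 1 + n + v * n + u)
                have h3 := bit_le_one x (n + 1 + n + u * n + v)
                have h4 := bit_le_one x (n + 1 + n + v * n + u)
                simp only [P, codedAdj, hu, hv, true_and, ← Nat.add_assoc]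
                by_cases c1 : IsOne x (n + 1 + n + u * n + v) <;>
                  by_cases c2 : IsOne x (n + 1 + n + v * n + u) <;>
                  simp only [c1, c2, not_true_eq_false, not_false_eq_true, iff_true, iff_false]
                    at h1 h2 <;> simp [c1, c2] <;> omega
              simp only [Env.reg_set, Exp.eval, hm', hrb, hcol, hrow', Env.mem_set, reduceCtorEq,
                if_false, if_true, hF' .order (by simp [hms]), ho, hF' .adjBase (by simp [hms]), ha,
                Nat.add_eq_zero_iff, hbad', ← hP, and_assoc]
              refine and_congr_right fun _ => ?_
              constructor
              · rintro ⟨h1, h2⟩ v' hv'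
                rcases Nat.lt_succ_iff_lt_or_eq.1 hv' with h | rfl
                · exact h1 v' h
                · exact h2
              · intro h
                exact ⟨fun v' hv' => h v' (by omega), h v (by omega)⟩
            · exact (((hF'.set (by simp [hms])).set (by simp [hms])).set (by simp [hms])).set
                (by simp [hms])
          · simp only [Exp.cost]; omega
        · rintro τ' ⟨-, hrow', hrb, hbad', hm', hF'⟩
          apply Tot.assign
          refine ⟨by simp [hrow'], by simp, ?_, hm', (hF'.set (by simp [hms])).set (by simp [hms])⟩
          have hC : bit x (n + 1 + n + u * n + u) = 0 ↔ ¬ codedAdj x n u u := by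
            rw [bit_eq_zero]; simp only [codedAdj, hu, true_and, ← Nat.add_assoc]
          simp only [Env.reg_set, Exp.eval, hm', hrb, hrow', reduceCtorEq,
                if_false, if_true, Nat.add_eq_zero_iff, hbad', hbad, hC, and_assoc]
          refine and_congr_right fun _ => ?_
          constructor
          · rintro ⟨h1, h2⟩ v' hv'
            rcases Nat.lt_succ_iff_lt_or_eq.1 hv' with h | rfl
            · exact h1 v' h
            · exact h2
          · intro h
            exact ⟨fun v' hv' => h v' (by omega), h u (by omega)⟩
      · simp only [Exp.cost]; nlinarith
    · rintro τ ⟨-, hbad, hm, hF⟩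
      refine ⟨hbad.trans ?_, hm, hF⟩
      constructor
      · rintro ⟨⟨h1, h2, h3⟩, h4⟩
        exact ⟨⟨h1, h2, fun u v h => (h4 u h.1).1 v h.2.1 h, fun u h => (h4 u h.1).2 h⟩, h3⟩
      · rintro ⟨⟨h1, h2, h3, h4⟩, h5⟩
        exact ⟨⟨h1, h2, h5⟩, fun u _ => ⟨fun v _ => h3 u v, h4 u⟩⟩
  · simp only [Exp.cost]
    have : 1 ≤ (n + 1) ^ 2 := Nat.one_le_pow _ _ (by omega)
    nlinarith

end RAM

/-! ### The edge case, the number of trees, and the initial domains -/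

namespace RAM

open Exp in
/-- Searches for an edge between the only two terminals. -/
def searchEdge : Prog :=
  forLoop .row (var .order)
    (.seq (assignMul .rowBase (var .row) (var .order))
    (.seq (assign .rowBase (add (var .adjBase) (var .rowBase)))
      (forLoop .col (var .order)
        (assign .ans (add (var .ans) (and (eq (var .numT) (const 2))
          (and (load (add (var .termBase) (var .row))) (and (load (add (var .termBase) (var .col)))
            (load (add (var .rowBase) (var .col)))))))))))

open Exp in
/-- Computes the number of parent functions. -/
def computeBound : Prog :=
  .seq (assign .bound (const 1))
    (forLoop .ix (var .param) (assignMul .bound (var .param) (var .bound)))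

open Exp in
/-- Writes the characteristic vectors of the domains of the nodes behind the input. -/
def initDomains : Prog :=
  .seq (assign .rank (var .budget))
    (forLoop .col (var .order)
      (.seq (forLoop .node (var .param)
        (.seq (assignMul .nodeBase (var .node) (var .order))
          (ite (load (add (var .termBase) (var .col)))
            (assignMem (add (var .len) (add (var .nodeBase) (var .col)))
              (eq (var .node) (var .rank)))
            (assignMem (add (var .len) (add (var .nodeBase) (var .col)))
              (sub (var .budget) (var .node))))))
        (assign .rank (add (var .rank) (load (add (var .termBase) (var .col)))))))

open Exp in
/-- Reads the parent of the next node. -/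
def readParent : Prog :=
  .seq (assign .node (sub (var .param) (add (var .ix) (const 1))))
  (.seq (assignDivMod .quot .parent (var .quot) (var .param))
    (ite (and (sub (var .node) (var .parent)) (sub (var .budget) (var .parent))) .skip
      (assign .parent (const 0))))

open Exp in
/-- Shrinks the domain of the parent to the vertices that are adjacent or equal to a vertex in the
domain of the node. -/
def shrinkParent : Prog :=
  .seq (assignMul .nodeBase (var .node) (var .order))
  (.seq (assignMul .parentBase (var .parent) (var .order))
    (forLoop .col (var .order)
      (.seq (assignMul .colBase (var .col) (var .order))
      (.seq (assign .colBase (add (var .adjBase) (var .colBase)))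
      (.seq (assign .flag (const 0))
      (.seq (forLoop .row (var .order)
          (assign .flag (add (var .flag) (and (load (add (var .len) (add (var .nodeBase) (var .row))))
            (add (load (add (var .colBase) (var .row))) (eq (var .col) (var .row)))))))
        (assignMem (add (var .len) (add (var .parentBase) (var .col)))
          (and (load (add (var .len) (add (var .parentBase) (var .col)))) (var .flag)))))))))

open Exp in
/-- Searches for a homomorphism from one of the trees. -/
def searchTrees : Prog :=
  forLoop .tree (var .bound)
    (.seq initDomains
    (.seq (assign .quot (var .tree))
    (.seq (forLoop .ix (sub (var .param) (const 1)) (.seq readParent shrinkParent))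
      (forLoop .col (var .order)
        (assign .ans (add (var .ans) (load (add (var .len) (var .col)))))))))

open Classical in
/-- The environment after the input has been read. -/
structure Ready (x : List Bool) (n p : ℕ) (σ : Env) : Prop where
  len : σ.reg .len = x.length
  param : σ.reg .param = p
  order : σ.reg .order = n
  termBase : σ.reg .termBase = n + 1
  adjBase : σ.reg .adjBase = n + 1 + n
  numT : σ.reg .numT = Nat.count (codedTerm x n) n
  budget : σ.reg .budget = codedK x n
  mem : ∀ i < x.length, σ.mem i = bit x i

theorem Ready.of_frame {x : List Bool} {n p : ℕ} {σ τ : Env} (h : Ready x n p σ) {ms : List Var}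
    (hF : Frame ms σ τ) (hmem : ∀ i < x.length, τ.mem i = σ.mem i)
    (hms : ∀ w ∈ [Var.len, .param, .order, .termBase, .adjBase, .numT, .budget], w ∉ ms) :
    Ready x n p τ where
  len := (hF _ (hms _ (by simp))).trans h.len
  param := (hF _ (hms _ (by simp))).trans h.param
  order := (hF _ (hms _ (by simp))).trans h.order
  termBase := (hF _ (hms _ (by simp))).trans h.termBase
  adjBase := (hF _ (hms _ (by simp))).trans h.adjBase
  numT := (hF _ (hms _ (by simp))).trans h.numT
  budget := (hF _ (hms _ (by simp))).trans h.budget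
  mem i hi := (hmem i hi).trans (h.mem i hi)

section

variable {x : List Bool} {n p : ℕ} {σ : Env}

theorem term_pos_lt (hx : headerLength n < x.length) {v : ℕ} (hv : v < n) :
    n + 1 + v < x.length := by
  unfold headerLength at hx; omega

theorem adj_pos_lt (hx : headerLength n < x.length) {u v : ℕ} (hu : u < n) (hv : v < n) :
    n + 1 + n + (u * n + v) < x.length := by
  have := Nat.mul_add_lt_mul hu hv
  unfold headerLength at hx; omega

theorem Ready.term_ne_zero (h : Ready x n p σ) (hx : headerLength n < x.length) {v : ℕ}
    (hv : v < n) : σ.mem (n + 1 + v) ≠ 0 ↔ codedTerm x n v := by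
  rw [h.mem _ (term_pos_lt hx hv), ne_eq, bit_eq_zero, not_not, codedTerm]
  simp [hv]

theorem Ready.adj_ne_zero (h : Ready x n p σ) (hx : headerLength n < x.length) {u v : ℕ}
    (hu : u < n) (hv : v < n) : σ.mem (n + 1 + n + (u * n + v)) ≠ 0 ↔ codedAdj x n u v := by
  rw [h.mem _ (adj_pos_lt hx hu hv), ne_eq, bit_eq_zero, not_not, codedAdj]
  simp [hu, hv]

theorem exists_lt_succ {P : ℕ → Prop} {j : ℕ} : (∃ i < j + 1, P i) ↔ (∃ i < j, P i) ∨ P j := by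
  constructor
  · rintro ⟨i, hi, h⟩
    rcases Nat.lt_succ_iff_lt_or_eq.1 hi with h' | rfl
    · exact Or.inl ⟨i, h', h⟩
    · exact Or.inr h
  · rintro (⟨i, hi, h⟩ | h)
    · exact ⟨i, by omega, h⟩
    · exact ⟨j, by omega, h⟩

theorem add_ne_zero_iff {a b : ℕ} : a + b ≠ 0 ↔ a ≠ 0 ∨ b ≠ 0 := by omega

open Classical in
theorem tot_searchEdge (hσ : Ready x n p σ) (hx : headerLength n < x.length) :
    Tot searchEdge σ (400 * (n + 1) ^ 2) fun τ =>
      (τ.reg .ans ≠ 0 ↔ σ.reg .ans ≠ 0 ∨ (Nat.count (codedTerm x n) n = 2 ∧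
        ∃ u v, codedTerm x n u ∧ codedTerm x n v ∧ codedAdj x n u v)) ∧
      τ.mem = σ.mem ∧ Frame [.ans, .row, .col, .rowBase] σ τ := by
  set ms : List Var := [.ans, .row, .col, .rowBase] with hms
  let P : ℕ → ℕ → Prop := fun u v => Nat.count (codedTerm x n) n = 2 ∧
    codedTerm x n u ∧ codedTerm x n v ∧ codedAdj x n u v
  have hR : ∀ {τ : Env}, τ.mem = σ.mem → Frame ms σ τ → Ready x n p τ := fun hm hF =>
    hσ.of_frame hF (fun i _ => by rw [hm]) (by simp [hms])
  apply Tot.weaken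
  · refine (Tot.forLoop (t := 200 * (n + 1)) (N := n) (fun u τ => τ.reg .row = u ∧
      (τ.reg .ans ≠ 0 ↔ σ.reg .ans ≠ 0 ∨ ∃ u' < u, ∃ v < n, P u' v) ∧
      τ.mem = σ.mem ∧ Frame ms σ τ) ?_ ?_ ?_).mono le_rfl ?_
    · rintro j τ ⟨hj, -, hm, hF⟩
      exact ⟨hj, by simp [(hR hm hF).order]⟩
    · exact ⟨by simp, by simp, rfl, (Frame.refl _ _).set (by simp [hms])⟩
    · rintro u hu τ ⟨hrow, hans, hm, hF⟩
      have hτ := hR hm hF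
      apply Tot.weaken
      · apply Tot.seq
        apply Tot.assignMul (N := n) (by simp [hrow]; omega)
        apply Tot.seq
        apply Tot.assign
        refine (Tot.forLoop (t := 100) (N := n) (fun v τ' => τ'.reg .col = v ∧
          τ'.reg .row = u ∧ τ'.reg .rowBase = n + 1 + n + u * n ∧
          (τ'.reg .ans ≠ 0 ↔ τ.reg .ans ≠ 0 ∨ ∃ v' < v, P u v') ∧
          τ'.mem = σ.mem ∧ Frame ms σ τ') ?_ ?_ ?_).mono le_rfl ?_
        · rintro j τ' ⟨hj, -, -, -, hm', hF'⟩
          exact ⟨hj, by simp [(hR hm' hF').order]⟩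
        · refine ⟨by simp, by simp [hrow], ?_, by simp, hm, ?_⟩
          · simp [hrow, hτ.order, hτ.adjBase]
          · exact ((hF.set (by simp [hms])).set (by simp [hms])).set (by simp [hms])
        · rintro v hv τ' ⟨hcol, hrow', hrb, hans', hm', hF'⟩
          have hτ' := hR hm' hF'
          apply Tot.weaken
          · apply Tot.assign
            refine ⟨by simp [hcol], by simp, by simp [hrow'], by simp [hrb], ?_, hm',
              (hF'.set (by simp [hms])).set (by simp [hms])⟩
            have hP : P u v ↔ Exp.eval τ' (Exp.and (Exp.eq (.var .numT) (.const 2))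
                (Exp.and (.load (.add (.var .termBase) (.var .row)))
                (Exp.and (.load (.add (.var .termBase) (.var .col)))
                (.load (.add (.var .rowBase) (.var .col)))))) ≠ 0 := by
              simp only [ne_eq, Exp.eval_and_eq_zero, Exp.eval_eq_eq_zero, not_not, P]
              simp only [Exp.eval, hτ'.numT, hτ'.termBase, hrow', hcol, hrb, Nat.add_assoc _ (u * n)]
              rw [← hτ'.term_ne_zero hx hu, ← hτ'.term_ne_zero hx hv, ← hτ'.adj_ne_zero hx hu hv]
            rw [exists_lt_succ, hP, ← or_assoc, ← hans', ← add_ne_zero_iff]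
            simp
          · simp
        · rintro τ' ⟨-, hrow', -, hans', hm', hF'⟩
          refine ⟨hrow', by simp, ?_, hm', hF'.set (by simp [hms])⟩
          rw [exists_lt_succ, ← or_assoc, ← hans, ← hans']
          simp
      · simp only [Exp.cost]; omega
    · rintro τ ⟨-, hans, hm, hF⟩
      refine ⟨hans.trans (or_congr_right ?_), hm, hF⟩
      constructor
      · rintro ⟨u, _, v, _, h, h'⟩
        exact ⟨h, u, v, h'⟩
      · rintro ⟨h, u, v, hu, hv, h'⟩
        exact ⟨u, hu.1, v, hv.1, h, hu, hv, h'⟩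
  · simp only [Exp.cost]; nlinarith

theorem tot_computeBound (hp : σ.reg .param = p) :
    Tot computeBound σ (100 * (p + 1) ^ 2) fun τ =>
      τ.reg .bound = p ^ p ∧ τ.mem = σ.mem ∧ Frame [.bound, .ix] σ τ := by
  apply Tot.weaken
  · apply Tot.seq
    apply Tot.assign
    -- Multiplication takes time linear in its first factor. That factor is `p`, so a round is cheap
    -- however large the accumulated power is.
    refine (Tot.forLoop (t := 9 * (p + 1)) (N := p) (fun j τ => τ.reg .ix = j ∧
      τ.reg .bound = p ^ j ∧ τ.mem = σ.mem ∧ Frame [.bound, .ix] σ τ) ?_ ?_ ?_).mono le_rfl ?_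
    · rintro j τ ⟨hj, -, -, hF⟩
      exact ⟨hj, by simp [hF .param (by simp), hp]⟩
    · exact ⟨by simp, by simp, rfl, ((Frame.refl _ _).set (by simp)).set (by simp)⟩
    · rintro j hj τ ⟨hi, hb, hm, hF⟩
      apply Tot.weaken
      · apply Tot.assignMul (N := p) (by simp [hF .param (by simp), hp])
        refine ⟨by simp [hi], by simp, ?_, hm, (hF.set (by simp)).set (by simp)⟩
        simp [hb, hF .param (by simp), hp, pow_succ, Nat.mul_comm]
      · simp; omega
    · rintro τ ⟨-, h⟩
      exact h
  · simp only [Exp.cost]; nlinarith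

/-- Different cells of the domain table have different addresses, so a write disturbs no other cell.
-/
theorem mul_add_inj {a b u v n : ℕ} (hu : u < n) (hv : v < n) (h : a * n + u = b * n + v) :
    a = b ∧ u = v := by
  have hn : 0 < n := by omega
  have h2 := congrArg (· % n) h
  simp only [Nat.mul_add_mod_self_right, Nat.mod_eq_of_lt hu, Nat.mod_eq_of_lt hv] at h2
  rw [h2] at h
  exact ⟨Nat.eq_of_mul_eq_mul_right hn (by omega), h2⟩

/-- The domains of the nodes in the memory. -/
def domain (x : List Bool) (n : ℕ) (σ : Env) (j v : ℕ) : Prop :=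
  v < n ∧ σ.mem (x.length + (j * n + v)) ≠ 0

open Classical in
-- While vertex `v` is processed, `rank` is `k` plus the number of terminals before `v`, that is,
-- the node of `v` if `v` is a terminal. For a non-terminal the entry is the truncated `k - j`,
-- nonzero exactly at the nodes `j < k`.
theorem tot_initDomains (hσ : Ready x n p σ) (hx : headerLength n < x.length) :
    Tot initDomains σ (200 * (n + 1) * ((p + 1) * (p + 1))) fun τ =>
      (∀ j < p, ∀ v, domain x n τ j v ↔ slot n (codedK x n) (codedTerm x n) j v) ∧
      (∀ i < x.length, τ.mem i = σ.mem i) ∧ Frame [.rank, .col, .node, .nodeBase] σ τ := by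
  set ms : List Var := [.rank, .col, .node, .nodeBase] with hms
  have hR : ∀ {τ : Env}, (∀ i < x.length, τ.mem i = σ.mem i) → Frame ms σ τ → Ready x n p τ :=
    fun hm hF => hσ.of_frame hF hm (by simp [hms])
  apply Tot.weaken
  · apply Tot.seq
    apply Tot.assign
    refine (Tot.forLoop (t := 150 * ((p + 1) * (p + 1))) (N := n) (fun v τ => τ.reg .col = v ∧
      τ.reg .rank = codedK x n + Nat.count (codedTerm x n) v ∧
      (∀ j < p, ∀ v' < v, τ.mem (x.length + (j * n + v')) ≠ 0 ↔
        slot n (codedK x n) (codedTerm x n) j v') ∧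
      (∀ i < x.length, τ.mem i = σ.mem i) ∧ Frame ms σ τ) ?_ ?_ ?_).mono le_rfl ?_
    · rintro j τ ⟨hj, -, -, hm, hF⟩
      exact ⟨hj, by simp [(hR hm hF).order]⟩
    · exact ⟨by simp, by simp [hσ.budget], by simp, fun _ _ => rfl,
        ((Frame.refl _ _).set (by simp [hms])).set (by simp [hms])⟩
    · rintro v hv τ ⟨hcol, hrank, hdom, hm, hF⟩
      apply Tot.weaken
      · apply Tot.seq
        refine (Tot.forLoop (t := 80 * (p + 1)) (N := p) (fun j τ' => τ'.reg .node = j ∧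
          τ'.reg .col = v ∧ τ'.reg .rank = codedK x n + Nat.count (codedTerm x n) v ∧
          (∀ j' < p, ∀ v' < v, τ'.mem (x.length + (j' * n + v')) ≠ 0 ↔
            slot n (codedK x n) (codedTerm x n) j' v') ∧
          (∀ j' < j, τ'.mem (x.length + (j' * n + v)) ≠ 0 ↔
            slot n (codedK x n) (codedTerm x n) j' v) ∧
          (∀ i < x.length, τ'.mem i = σ.mem i) ∧ Frame ms σ τ') ?_ ?_ ?_).mono le_rfl ?_
        · rintro j τ' ⟨hj, -, -, -, -, hm', hF'⟩
          exact ⟨hj, by simp [(hR hm' hF').param]⟩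
        · exact ⟨by simp, by simp [hcol], by simp [hrank], hdom, by simp, hm,
            hF.set (by simp [hms])⟩
        · rintro j hj τ' ⟨hnode, hcol', hrank', hdom', hdomv, hm', hF'⟩
          have hτ' := hR hm' hF'
          -- The part common to both branches: any written value that is nonzero exactly for members
          -- of the domain maintains the invariant.
          have fin : ∀ y : ℕ, (y ≠ 0 ↔ slot n (codedK x n) (codedTerm x n) j v) →
              ∀ ρ : Env, ρ = (τ'.set .nodeBase (j * n)).put (x.length + (j * n + v)) y →
              ρ.reg .node = j ∧ (ρ.set .node (j + 1)).reg .node = j + 1 ∧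
              (ρ.set .node (j + 1)).reg .col = v ∧
              (ρ.set .node (j + 1)).reg .rank = codedK x n + Nat.count (codedTerm x n) v ∧
              (∀ j' < p, ∀ v' < v, (ρ.set .node (j + 1)).mem (x.length + (j' * n + v')) ≠ 0 ↔
                slot n (codedK x n) (codedTerm x n) j' v') ∧
              (∀ j' < j + 1, (ρ.set .node (j + 1)).mem (x.length + (j' * n + v)) ≠ 0 ↔
                slot n (codedK x n) (codedTerm x n) j' v) ∧
              (∀ i < x.length, (ρ.set .node (j + 1)).mem i = σ.mem i) ∧
              Frame ms σ (ρ.set .node (j + 1)) := by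
            rintro y hy ρ rfl
            refine ⟨by simp [hnode], by simp, by simp [hcol'], by simp [hrank'],
              fun j' hj' v' hv' => ?_, fun j' hj' => ?_, fun i hi => ?_, ?_⟩
            · rw [← hdom' j' hj' v' hv']
              have hne : ¬ (j' * n + v' = j * n + v) := fun e => by
                have := (mul_add_inj (by omega) hv e).2
                omega
              simp [hne]
            · by_cases e : j' = j
              · subst e; simpa using hy
              · have hne : ¬ (j' * n + v = j * n + v) := fun e' => e (mul_add_inj hv hv e').1
                rw [← hdomv j' (by omega)]
                simp only [Env.mem_set, Env.mem_put, Nat.add_left_cancel_iff, if_neg hne]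
            · simp only [Env.mem_set, Env.mem_put]
              rw [if_neg (by omega), hm' i hi]
            · have h1 : Frame ms σ (τ'.set .nodeBase (j * n)) := hF'.set (by simp [hms])
              have h2 : Frame ms σ ((τ'.set .nodeBase (j * n)).put (x.length + (j * n + v)) y) := h1
              exact h2.set (by simp [hms])
          have hslot := hτ'.term_ne_zero hx hv
          apply Tot.weaken
          · apply Tot.seq
            apply Tot.assignMul (N := p) (by simp [hnode]; omega)
            apply Tot.ite (t := 40)
            · intro hne
              simp only [Exp.eval, Env.reg_set, reduceCtorEq, if_false, hcol', hτ'.termBase,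
                Env.mem_set] at hne
              have hT := hslot.1 hne
              apply Tot.weaken
              · apply Tot.assignMem
                refine fin _ ?_ _ (by simp [hnode, hτ'.order, hτ'.len, hcol']; rfl)
                rw [ne_eq, Exp.eval_eq_eq_zero, not_not]
                simp [hnode, hrank', slot, hT, hv]
              · simp
            · intro hne
              simp only [Exp.eval, Env.reg_set, reduceCtorEq, if_false, hcol', hτ'.termBase,
                Env.mem_set] at hne
              have hT : ¬ codedTerm x n v := fun h => hslot.2 h hne
              apply Tot.weaken
              · apply Tot.assignMem
                refine fin _ ?_ _ (by simp [hnode, hτ'.order, hτ'.len, hcol']; rfl)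
                simp [slot, hT, hv, hτ'.budget, Nat.sub_eq_zero_iff_le]
              · simp
          · simp only [Exp.cost]; omega
        · rintro τ' ⟨-, hcol', hrank', hdom', hdomv, hm', hF'⟩
          have hτ' := hR hm' hF'
          apply Tot.assign
          refine ⟨by simp [hcol'], by simp, ?_, fun j hj v' hv' => ?_, hm',
            (hF'.set (by simp [hms])).set (by simp [hms])⟩
          · have hbit : τ'.mem (n + 1 + v) = if codedTerm x n v then 1 else 0 := by
              rw [hτ'.mem _ (term_pos_lt hx hv)]
              simp [bit, codedTerm, hv, IsOne]
            simp [hrank', hτ'.termBase, hcol', hbit, Nat.count_succ, Nat.add_assoc (codedK x n)]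
          · rcases Nat.lt_succ_iff_lt_or_eq.1 hv' with h | rfl
            · exact hdom' j hj v' h
            · exact hdomv j hj
      · simp only [Exp.cost]; nlinarith
    · rintro τ ⟨-, -, hdom, hm, hF⟩
      refine ⟨fun j hj v => ?_, hm, hF⟩
      constructor
      · rintro ⟨hv, h⟩
        exact (hdom j hj v hv).1 h
      · intro h
        exact ⟨h.1, (hdom j hj v h.1).2 h⟩
  · simp only [Exp.cost]
    generalize hz : (p + 1) * (p + 1) = z
    have hz1 : 1 ≤ z := by rw [← hz]; exact Nat.mul_pos (by omega) (by omega)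
    have := Nat.mul_le_mul_left (n + 1) hz1
    nlinarith

end

end RAM

/-! ### Enumerating the trees and eliminating their nodes -/

namespace RAM

/-- The parent of node `j` in the tree with number `m`, whose base-`p` digits are the parents of the
nodes in descending order. Digits out of range are replaced by `0`. -/
def parentOf (p k m j : ℕ) : ℕ :=
  if m / p ^ (p - 1 - j) % p < j ∧ m / p ^ (p - 1 - j) % p < k then m / p ^ (p - 1 - j) % p else 0

theorem parentOf_lt {p k m j : ℕ} (hj : 1 ≤ j) : parentOf p k m j < j := by
  unfold parentOf; split_ifs with h
  · exact h.1
  · omega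

theorem parentOf_lt_right {p k m j : ℕ} (hk : 0 < k) : parentOf p k m j < k := by
  unfold parentOf; split_ifs with h
  · exact h.2
  · exact hk

theorem exists_parentOf_eq {p k : ℕ} (par : ℕ → ℕ)
    (hpar : ∀ j, 1 ≤ j → j < p → par j < j ∧ par j < k) :
    ∃ m < p ^ p, ∀ j, 1 ≤ j → j < p → parentOf p k m j = par j := by
  rcases Nat.eq_zero_or_pos p with rfl | hp
  · exact ⟨0, by simp, fun j _ h => absurd h (Nat.not_lt_zero _)⟩
  -- Digit `i` belongs to node `p - 1 - i`, since digits are read from the least significant one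
  -- while nodes are eliminated from the last. The reduction mod `p` only matters for node `0`,
  -- whose parent is unconstrained.
  let g : Fin p → Fin p := fun i => ⟨par (p - 1 - i) % p, Nat.mod_lt _ hp⟩
  refine ⟨finFunctionFinEquiv g, (finFunctionFinEquiv g).2, fun j hj hj' => ?_⟩
  have hg : (finFunctionFinEquiv g : ℕ) / p ^ (p - 1 - j) % p = par j := by
    have h1 := congrFun (finFunctionFinEquiv.symm_apply_apply g) ⟨p - 1 - j, by omega⟩
    have h2 := congrArg Fin.val h1
    rw [finFunctionFinEquiv_symm_apply_val] at h2
    rw [h2]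
    have h3 : p - 1 - (p - 1 - j) = j := by omega
    simp only [g, h3]
    exact Nat.mod_eq_of_lt (by have := hpar j hj hj'; omega)
  unfold parentOf
  rw [hg, if_pos (hpar j hj hj')]

section

variable {x : List Bool} {n p : ℕ} {σ : Env}

/-- Round `i` splits off digit `i` of `m` by one division by `p`. Division is repeated subtraction,
which is why the time is linear in the bound `M` on the tree number. -/
theorem tot_readParent (hσ : Ready x n p σ) {i m M : ℕ} (hi : i < p - 1) (hm : m ≤ M)
    (hix : σ.reg .ix = i) (hquot : σ.reg .quot = m / p ^ i) :
    Tot readParent σ (60 * (M + 1)) fun τ =>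
      τ.reg .node = p - (i + 1) ∧ τ.reg .quot = m / p ^ (i + 1) ∧
      τ.reg .parent = parentOf p (codedK x n) m (p - (i + 1)) ∧
      τ.mem = σ.mem ∧ Frame [.node, .quot, .parent] σ τ := by
  have hdiv : m / p ^ i ≤ M := (Nat.div_le_self _ _).trans hm
  have hj : p - 1 - (p - (i + 1)) = i := by omega
  have hF : ∀ y₁ y₂ y₃, Frame [.node, .quot, .parent] σ
      (((σ.set .node y₁).set .quot y₂).set .parent y₃) := fun _ _ _ =>
    (((Frame.refl _ _).set (by simp)).set (by simp)).set (by simp)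
  apply Tot.weaken
  · apply Tot.seq
    apply Tot.assign
    apply Tot.seq
    apply Tot.assignDivMod (N := M) (by simp) (by simp [hσ.param]; omega) (by simpa [hquot] using hdiv)
    apply Tot.ite (t := 3)
    · intro hne
      rw [ne_eq, Exp.eval_and_eq_zero, not_not] at hne
      simp only [Exp.eval, Env.reg_set, reduceCtorEq, if_false, if_true, hσ.param, hix, hquot,
        hσ.budget] at hne
      refine (Tot.skip ?_).weaken (by omega)
      refine ⟨by simp [hσ.param, hix], ?_, ?_, rfl, hF _ _ _⟩
      · simp [hquot, hσ.param, Nat.div_div_eq_div_mul, pow_succ]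
      · unfold parentOf
        rw [hj, if_pos (by omega)]
        simp [hquot, hσ.param]
    · intro hne
      rw [Exp.eval_and_eq_zero] at hne
      simp only [Exp.eval, Env.reg_set, reduceCtorEq, if_false, if_true, hσ.param, hix, hquot,
        hσ.budget] at hne
      refine (Tot.assign ?_).weaken (by simp)
      refine ⟨by simp [hσ.param, hix], ?_, ?_, rfl, (hF _ _ _).set (by simp)⟩
      · simp [hquot, hσ.param, Nat.div_div_eq_div_mul, pow_succ]
      · unfold parentOf
        rw [hj, if_neg (by omega)]
        simp
  · simp only [Exp.cost, Exp.cost_and]; omega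

/-- Row `d` of the table is overwritten in place. This is safe because `d < j`: row `j` is only
read, and a cell of row `d` is consulted only when it is itself replaced. -/
theorem tot_shrinkParent (hσ : Ready x n p σ) (hx : headerLength n < x.length) {j d : ℕ}
    (hj : j < p) (hd : d < j) (hnode : σ.reg .node = j) (hparent : σ.reg .parent = d) :
    Tot shrinkParent σ (300 * ((n + 1) * (n + 1)) + 20 * (p + 1)) fun τ =>
      (∀ v, domain x n τ d v ↔ domain x n σ d v ∧
        ∃ u, domain x n σ j u ∧ (codedAdj x n v u ∨ v = u)) ∧
      (∀ a, a ≠ d → ∀ v, domain x n τ a v ↔ domain x n σ a v) ∧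
      (∀ i < x.length, τ.mem i = σ.mem i) ∧
      Frame [.nodeBase, .parentBase, .col, .colBase, .flag, .row] σ τ := by
  set ms : List Var := [.nodeBase, .parentBase, .col, .colBase, .flag, .row] with hms
  have hR : ∀ {τ : Env}, (∀ i < x.length, τ.mem i = σ.mem i) → Frame ms σ τ → Ready x n p τ :=
    fun hm hF => hσ.of_frame hF hm (by simp [hms])
  let P : ℕ → ℕ → Prop := fun v u =>
    σ.mem (x.length + (j * n + u)) ≠ 0 ∧ (codedAdj x n v u ∨ v = u)
  apply Tot.weaken
  · apply Tot.seq
    apply Tot.assignMul (N := p) (by simp [hnode]; omega)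
    apply Tot.seq
    apply Tot.assignMul (N := p) (by simp [hparent]; omega)
    refine (Tot.forLoop (t := 200 * (n + 1)) (N := n) (fun v τ => τ.reg .col = v ∧
      τ.reg .nodeBase = j * n ∧ τ.reg .parentBase = d * n ∧
      (∀ v' < v, τ.mem (x.length + (d * n + v')) ≠ 0 ↔
        σ.mem (x.length + (d * n + v')) ≠ 0 ∧ ∃ u < n, P v' u) ∧
      (∀ a, (∀ v' < v, a ≠ x.length + (d * n + v')) → τ.mem a = σ.mem a) ∧
      Frame ms σ τ) ?_ ?_ ?_).mono le_rfl ?_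
    · rintro v τ ⟨hv, -, -, -, hm, hF⟩
      exact ⟨hv, by simp [(hR (fun i hi => hm i (by intros; omega)) hF).order]⟩
    · refine ⟨by simp, by simp [hnode, hσ.order], by simp [hparent, hσ.order], by simp,
        fun _ _ => rfl, ?_⟩
      exact (((Frame.refl _ _).set (by simp [hms])).set (by simp [hms])).set (by simp [hms])
    · rintro v hv τ ⟨hcol, hnb, hpb, hdom, hm, hF⟩
      have hτ : Ready x n p τ := hR (fun i hi => hm i (by intros; omega)) hF
      apply Tot.weaken
      · apply Tot.seq
        apply Tot.assignMul (N := n) (by simp [hcol]; omega)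
        apply Tot.seq
        apply Tot.assign
        apply Tot.seq
        apply Tot.assign
        apply Tot.seq
        refine (Tot.forLoop (t := 60) (N := n) (fun u τ' => τ'.reg .row = u ∧ τ'.reg .col = v ∧
          τ'.reg .nodeBase = j * n ∧ τ'.reg .parentBase = d * n ∧
          τ'.reg .colBase = n + 1 + n + v * n ∧
          (τ'.reg .flag ≠ 0 ↔ ∃ u' < u, P v u') ∧ τ'.mem = τ.mem ∧ Frame ms σ τ')
          ?_ ?_ ?_).mono le_rfl ?_
        · rintro u τ' ⟨hu, -, -, -, -, -, -, hF'⟩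
          exact ⟨hu, by simp [hF' .order (by simp [hms]), hσ.order]⟩
        · refine ⟨by simp, by simp [hcol], by simp [hnb], by simp [hpb], ?_, by simp, rfl, ?_⟩
          · simp [hcol, hτ.order, hτ.adjBase]
          · exact (((hF.set (by simp [hms])).set (by simp [hms])).set (by simp [hms])).set
              (by simp [hms])
        · rintro u hu τ' ⟨hrow, hcol', hnb', hpb', hcb, hflag, hm', hF'⟩
          have hτ' : Ready x n p τ' :=
            hR (fun i hi => by rw [hm']; exact hm i (by intros; omega)) hF'
          apply Tot.weaken
          · apply Tot.assign
            refine ⟨by simp [hrow], by simp, by simp [hcol'], by simp [hnb'], by simp [hpb'],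
              by simp [hcb], ?_, hm', (hF'.set (by simp [hms])).set (by simp [hms])⟩
            have hP : P v u ↔ Exp.eval τ' (Exp.and
                (.load (.add (.var .len) (.add (.var .nodeBase) (.var .row))))
                (.add (.load (.add (.var .colBase) (.var .row)))
                  (Exp.eq (.var .col) (.var .row)))) ≠ 0 := by
              have hcell : τ'.mem (x.length + (j * n + u)) = σ.mem (x.length + (j * n + u)) := by
                rw [hm']
                refine hm _ fun v' hv' e => ?_
                have := (mul_add_inj hu (by omega) (Nat.add_left_cancel e)).1
                omega
              have heq := Exp.eval_eq_eq_zero (σ := τ') (a := .var .col) (b := .var .row)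
              rw [ne_eq, Exp.eval_and_eq_zero, not_not]
              simp only [Exp.eval, hτ'.len, hnb', hrow, hcb, hcol', Nat.add_assoc _ (v * n),
                add_ne_zero_iff, hcell, P] at heq ⊢
              rw [← hτ'.adj_ne_zero hx hv hu]
              simp only [ne_eq, heq, not_not]
            rw [exists_lt_succ, hP, ← hflag, ← add_ne_zero_iff]
            simp
          · simp
        · rintro τ' ⟨-, hcol', hnb', hpb', -, hflag, hm', hF'⟩
          have hlen' : τ'.reg .len = x.length := (hF' .len (by simp [hms])).trans hσ.len
          apply Tot.assignMem
          have haddr : Exp.eval τ' (.add (.var .len) (.add (.var .parentBase) (.var .col))) =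
              x.length + (d * n + v) := by simp [hlen', hpb', hcol']
          have hval : Exp.eval τ' (Exp.and
              (.load (.add (.var .len) (.add (.var .parentBase) (.var .col)))) (.var .flag)) ≠ 0 ↔
              σ.mem (x.length + (d * n + v)) ≠ 0 ∧ ∃ u < n, P v u := by
            rw [ne_eq, Exp.eval_and_eq_zero, not_not, ← hflag]
            have hcell : τ'.mem (x.length + (d * n + v)) = σ.mem (x.length + (d * n + v)) := by
              rw [hm']
              refine hm _ fun v' hv' e => ?_
              have := (mul_add_inj hv (by omega) (Nat.add_left_cancel e)).2
              omega
            simp only [Exp.eval, hlen', hpb', hcol', hcell]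
          rw [haddr]
          generalize Exp.eval τ' (Exp.and
              (.load (.add (.var .len) (.add (.var .parentBase) (.var .col)))) (.var .flag)) = y
            at hval ⊢
          refine ⟨by simp [hcol'], by simp, by simp [hnb'], by simp [hpb'], fun v' hv' => ?_,
            fun a ha => ?_, ?_⟩
          · rcases Nat.lt_succ_iff_lt_or_eq.1 hv' with h | rfl
            · rw [← hdom v' h, ← hm']
              simp only [Env.mem_set, Env.mem_put, Nat.add_left_cancel_iff, h.ne, if_false]
            · simpa using hval
          · simp only [Env.mem_set, Env.mem_put]
            rw [if_neg (ha v (by omega)), hm']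
            exact hm a fun v' hv' => ha v' (by omega)
          · have h1 : Frame ms σ (τ'.put (x.length + (d * n + v)) y) := hF'
            exact h1.set (by simp [hms])
      · simp only [Exp.cost, Exp.cost_and]; omega
    · rintro τ ⟨-, -, -, hdom, hm, hF⟩
      refine ⟨fun v => ?_, fun a ha v => ?_, fun i hi => hm i (by intros; omega), hF⟩
      · constructor
        · rintro ⟨hv, h⟩
          obtain ⟨h1, u, hu, h2, h3⟩ := (hdom v hv).1 h
          exact ⟨⟨hv, h1⟩, u, ⟨hu, h2⟩, h3⟩
        · rintro ⟨⟨hv, h1⟩, u, ⟨hu, h2⟩, h3⟩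
          exact ⟨hv, (hdom v hv).2 ⟨h1, u, hu, h2, h3⟩⟩
      · refine and_congr_right fun hv => ?_
        rw [hm]
        intro v' hv' e
        exact ha (mul_add_inj hv hv' (Nat.add_left_cancel e)).1
  · simp only [Exp.cost]; nlinarith

theorem treeHom_congr {D D' A : ℕ → ℕ → Prop} {par par' : ℕ → ℕ} {J : ℕ}
    (hD : ∀ j < J, ∀ v, D j v ↔ D' j v) (hpar : ∀ j, 1 ≤ j → j < J → par j = par' j) :
    TreeHom D A par J ↔ TreeHom D' A par' J := by
  refine exists_congr fun φ => and_congr ?_ ?_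
  · exact forall_congr' fun j => forall_congr' fun hj => hD j hj _
  · refine forall_congr' fun j => forall_congr' fun h1 => forall_congr' fun h2 => ?_
    rw [hpar j h1 h2]

theorem treeHom_one {D A : ℕ → ℕ → Prop} {par : ℕ → ℕ} : TreeHom D A par 1 ↔ ∃ v, D 0 v := by
  constructor
  · rintro ⟨φ, h, -⟩
    exact ⟨φ 0, h 0 (by omega)⟩
  · rintro ⟨v, hv⟩
    refine ⟨fun _ => v, fun j hj => ?_, fun j h1 h2 => by omega⟩
    obtain rfl : j = 0 := by omega
    exact hv

/-- Bounds every summand of a running time by one common monomial, after which only constants have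
to be compared. -/
theorem monomial_le_monomial {a b c i j k I J K : ℕ} (ha : 1 ≤ a) (hb : 1 ≤ b) (hc : 1 ≤ c)
    (hi : i ≤ I) (hj : j ≤ J) (hk : k ≤ K) : a ^ i * b ^ j * c ^ k ≤ a ^ I * b ^ J * c ^ K :=
  Nat.mul_le_mul (Nat.mul_le_mul (Nat.pow_le_pow_right ha hi) (Nat.pow_le_pow_right hb hj))
    (Nat.pow_le_pow_right hc hk)

theorem tot_searchTrees (hσ : Ready x n p σ) (hx : headerLength n < x.length) (hp : 1 ≤ p) {B : ℕ}
    (hB : σ.reg .bound = B) :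
    Tot searchTrees σ (2000 * ((B + 1) ^ 2 * (p + 1) ^ 2 * (n + 1) ^ 2)) fun τ =>
      τ.reg .ans ≠ 0 ↔ σ.reg .ans ≠ 0 ∨ ∃ m < B,
        TreeHom (slot n (codedK x n) (codedTerm x n)) (codedAdj x n) (parentOf p (codedK x n) m)
          p := by
  set ms : List Var := [.tree, .rank, .col, .node, .nodeBase, .quot, .ix, .parent, .parentBase,
    .colBase, .flag, .row, .ans] with hms
  let P : ℕ → ℕ → Env → Prop := fun m J τ =>
    TreeHom (domain x n τ) (codedAdj x n) (parentOf p (codedK x n) m) J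
  let S : ℕ → Prop := fun m => TreeHom (slot n (codedK x n) (codedTerm x n)) (codedAdj x n)
    (parentOf p (codedK x n) m) p
  have hR : ∀ {τ : Env}, (∀ i < x.length, τ.mem i = σ.mem i) → Frame ms σ τ → Ready x n p τ :=
    fun hm hF => hσ.of_frame hF hm (by simp [hms])
  have hb : ∀ {τ : Env}, Frame ms σ τ → τ.reg .bound = B := fun hF =>
    (hF .bound (by simp [hms])).trans hB
  apply Tot.weaken
  · refine (Tot.forLoop (t := 1500 * ((B + 1) * (p + 1) ^ 2 * (n + 1) ^ 2)) (N := B)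
      (fun m τ => τ.reg .tree = m ∧ (τ.reg .ans ≠ 0 ↔ σ.reg .ans ≠ 0 ∨ ∃ m' < m, S m') ∧
        (∀ i < x.length, τ.mem i = σ.mem i) ∧ Frame ms σ τ) ?_ ?_ ?_).mono le_rfl ?_
    · rintro m τ ⟨hm, -, -, hF⟩
      exact ⟨hm, by simp [hb hF]⟩
    · exact ⟨by simp, by simp, fun _ _ => rfl, (Frame.refl _ _).set (by simp [hms])⟩
    · rintro m hmB τ ⟨htree, hans, hm, hF⟩
      apply Tot.weaken
      · apply Tot.seq
        refine (tot_initDomains (hR hm hF) hx).mono le_rfl ?_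
        rintro τ₁ ⟨hdom₁, hm₁, hF₁⟩
        apply Tot.seq
        apply Tot.assign
        apply Tot.seq
        have hm₁' : ∀ i < x.length, τ₁.mem i = σ.mem i := fun i hi =>
          (hm₁ i hi).trans (hm i hi)
        have hF₁' : Frame ms σ τ₁ := hF.trans hF₁ (by simp [hms])
        refine (Tot.forLoop (t := 60 * (B + 1) + (300 * ((n + 1) * (n + 1)) + 20 * (p + 1)))
          (N := p - 1)
          (fun i τ' => τ'.reg .ix = i ∧ τ'.reg .quot = m / p ^ i ∧ τ'.reg .tree = m ∧
            τ'.reg .ans = τ.reg .ans ∧ (i ≤ p - 1 → (P m (p - i) τ' ↔ S m)) ∧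
            (∀ i < x.length, τ'.mem i = σ.mem i) ∧ Frame ms σ τ') ?_ ?_ ?_).mono le_rfl ?_
        · rintro i τ' ⟨hi, -, -, -, -, hm', hF'⟩
          exact ⟨hi, by simp [(hR hm' hF').param]⟩
        · have ht₁ : τ₁.reg .tree = m := (hF₁ .tree (by simp)).trans htree
          have ha₁ : τ₁.reg .ans = τ.reg .ans := hF₁ .ans (by simp)
          refine ⟨by simp, by simp [ht₁], by simp [ht₁], by simp [ha₁], fun _ => ?_, hm₁', ?_⟩
          · exact treeHom_congr hdom₁ fun _ _ _ => rfl
          · exact (hF₁'.set (by simp [hms])).set (by simp [hms])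
        · rintro i hi τ₂ ⟨hix, hq, ht₂, ha₂, hP, hm₂, hF₂⟩
          apply Tot.seq
          refine (tot_readParent (hR hm₂ hF₂) hi hmB.le hix hq).mono le_rfl ?_
          rintro τ₃ ⟨hnode, hq₃, hpar, hm₃, hF₃⟩
          have hm₃' : ∀ i < x.length, τ₃.mem i = σ.mem i := by rw [hm₃]; exact hm₂
          have hF₃' : Frame ms σ τ₃ := hF₂.trans hF₃ (by simp [hms])
          have hj1 : 1 ≤ p - (i + 1) := by omega
          refine (tot_shrinkParent (hR hm₃' hF₃') hx (by omega) (parentOf_lt hj1) hnode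
            hpar).mono le_rfl ?_
          rintro τ₄ ⟨hdom, hdom', hm₄, hF₄⟩
          refine ⟨?_, by simp, ?_, ?_, ?_, fun _ => ?_, fun i hi => (hm₄ i hi).trans (hm₃' i hi), ?_⟩
          · rw [hF₄ .ix (by simp), hF₃ .ix (by simp), hix]
          · simp [hF₄ .quot (by simp), hq₃]
          · simp [hF₄ .tree (by simp), hF₃ .tree (by simp), ht₂]
          · simp [hF₄ .ans (by simp), hF₃ .ans (by simp), ha₂]
          · rw [← hP (by omega)]
            have e : p - i = p - (i + 1) + 1 := by omega
            have hD₃ : ∀ j v, domain x n τ₃ j v ↔ domain x n τ₂ j v := fun j v => by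
              simp only [domain, hm₃]
            have hD₄ : P m (p - (i + 1)) (τ₄.set .ix (i + 1)) ↔ P m (p - (i + 1)) τ₄ := Iff.rfl
            rw [hD₄, e]
            refine (treeHom_succ_iff (fun j hj _ => parentOf_lt hj) hj1 ?_ ?_).symm
            · intro j _ hne v
              rw [hdom' j hne, hD₃]
            · intro v
              rw [hdom v]
              simp only [hD₃]
          · exact (hF₃'.trans hF₄ (by simp [hms])).set (by simp [hms])
        · rintro τ₂ ⟨-, -, ht₂, ha₂, hP, hm₂, hF₂⟩
          -- Only the root is left; its row is the first one and starts directly behind the input.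
          have hP' : (∃ v < n, τ₂.mem (x.length + v) ≠ 0) ↔ S m := by
            rw [← hP le_rfl, show p - (p - 1) = 1 by omega]
            refine Iff.trans ?_ treeHom_one.symm
            simp [domain]
          refine (Tot.forLoop (t := 40) (N := n) (fun v τ' => τ'.reg .col = v ∧
            τ'.reg .tree = m ∧ (τ'.reg .ans ≠ 0 ↔ τ.reg .ans ≠ 0 ∨
              ∃ v' < v, τ₂.mem (x.length + v') ≠ 0) ∧ τ'.mem = τ₂.mem ∧ Frame ms σ τ')
              ?_ ?_ ?_).mono le_rfl ?_
          · rintro v τ' ⟨hv, -, -, -, hF'⟩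
            exact ⟨hv, by simp [hF' .order (by simp [hms]), hσ.order]⟩
          · exact ⟨by simp, by simp [ht₂], by simp [ha₂], rfl, hF₂.set (by simp [hms])⟩
          · rintro v hv τ' ⟨hcol, ht', ha', hm', hF'⟩
            apply Tot.weaken
            · apply Tot.assign
              refine ⟨by simp [hcol], by simp, by simp [ht'], ?_, hm',
                (hF'.set (by simp [hms])).set (by simp [hms])⟩
              rw [exists_lt_succ, ← or_assoc, ← ha', ← add_ne_zero_iff]
              simp [hm', hcol, hF' .len (by simp [hms]), hσ.len]
            · simp
          · rintro τ' ⟨-, ht', ha', hm', hF'⟩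
            refine ⟨ht', by simp, ?_, fun i hi => by simp [hm', hm₂ i hi],
              hF'.set (by simp [hms])⟩
            rw [exists_lt_succ, ← or_assoc, ← hans, ← hP', ← ha']
            simp
      · simp only [Exp.cost]
        have mono := fun {i j k : ℕ} => monomial_le_monomial (i := i) (j := j) (k := k) (I := 1)
          (J := 2) (K := 2) (Nat.le_add_left 1 B) (Nat.le_add_left 1 p) (Nat.le_add_left 1 n)
        have h₁ := mono (i := 0) (j := 2) (k := 1) (by omega) (by omega) (by omega)
        have h₂ := mono (i := 0) (j := 0) (k := 0) (by omega) (by omega) (by omega)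
        have h₃ := mono (i := 1) (j := 1) (k := 0) (by omega) (by omega) (by omega)
        have h₄ := mono (i := 0) (j := 1) (k := 2) (by omega) (by omega) (by omega)
        have h₅ := mono (i := 0) (j := 2) (k := 0) (by omega) (by omega) (by omega)
        have h₆ := mono (i := 0) (j := 0) (k := 1) (by omega) (by omega) (by omega)
        have h₇ := mono (i := 0) (j := 1) (k := 0) (by omega) (by omega) (by omega)
        rw [pow_one (B + 1)] at *
        have hle : p - 1 + 1 ≤ p + 1 := by omega
        generalize (B + 1) * (p + 1) ^ 2 * (n + 1) ^ 2 = M at *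
        have h₈ := Nat.mul_le_mul_right (60 * (B + 1) + (300 * ((n + 1) * (n + 1)) + 20 * (p + 1)) +
          (2 + 1 + 1) + 16) hle
        nlinarith
    · rintro τ ⟨-, h, -⟩
      exact h
  · simp only [Exp.cost]
    have h : 1 ≤ (B + 1) * (p + 1) ^ 2 * (n + 1) ^ 2 := Nat.mul_pos (by positivity) (by positivity)
    have e : (B + 1) ^ 2 * (p + 1) ^ 2 * (n + 1) ^ 2 =
      (B + 1) * ((B + 1) * (p + 1) ^ 2 * (n + 1) ^ 2) := by ring
    rw [e]
    generalize (B + 1) * (p + 1) ^ 2 * (n + 1) ^ 2 = M at *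
    nlinarith

end

end RAM

/-! ### The complete program and its running time -/

namespace RAM

/-- Reads and checks the input. -/
def readInput : Prog := .seq readHeader (.seq countTerminals (.seq readBudget validate))

/-- The program for Terminal Steiner Tree. -/
def steinerProgram : Prog :=
  .seq readInput (.seq (assign .ans (.const 0))
    (.seq (ite (.var .bad) .skip (.seq searchEdge (.seq computeBound searchTrees)))
      (assign .len (.var .ans))))

/-- The initial environment. -/
def initEnv (x : List Bool) (p : ℕ) : Env where
  reg v := if v = .len then x.length else if v = .param then p else 0
  mem := bit x

theorem realizes_init (x : List Bool) (p : ℕ) : Realizes (init x p) (initEnv x p) := by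
  refine ⟨rfl, fun v => ?_⟩
  cases v <;> rfl

open Classical in
theorem tot_readInput (x : List Bool) (p : ℕ) :
    Tot readInput (initEnv x p) (1000 * (x.length + 1) ^ 3) fun τ =>
      ∃ n ≤ x.length, (∀ i < n, IsOne x i) ∧ ¬ IsOne x n ∧ Ready x n p τ ∧
        (τ.reg .bad = 0 ↔ IsCode x n ∧
          codedK x n + Nat.count (codedTerm x n) n = p) := by
  have hle : ∀ n ≤ x.length, n + 1 ≤ x.length + 1 := fun n hn => by omega
  apply Tot.weaken
  · apply Tot.seq
    refine (tot_readHeader (x := x) (by simp [initEnv]) rfl).mono le_rfl ?_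
    rintro τ₁ ⟨n, hn, h1, h2, hm₁, ho, ht, ha, hb, hF₁⟩
    apply Tot.seq
    refine (tot_countTerminals hm₁ ho ht).mono
      (Nat.mul_le_mul_left 100 (hle n hn)) ?_
    rintro τ₂ ⟨hT, hm₂, hF₂⟩
    apply Tot.seq
    have hlen₁ : τ₁.reg .len = x.length := hF₁ .len (by simp)
    have hpar₁ : τ₁.reg .param = p := hF₁ .param (by simp)
    refine (tot_readBudget (n := n) hm₂ ((hF₂ .len (by simp)).trans hlen₁)
      ((hF₂ .bitsBase (by simp)).trans hb)).mono le_rfl ?_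
    rintro τ₃ ⟨hk, hm₃, hF₃⟩
    have hF : Frame [.ix, .budget, .numT] τ₁ τ₃ :=
      (Frame.trans (Frame.refl _ _) hF₂ (by simp)).trans hF₃ (by simp)
    have hT₃ := (hF₃ .numT (by simp)).trans hT
    have hlen₃ := (hF .len (by simp)).trans hlen₁
    have hpar₃ := (hF .param (by simp)).trans hpar₁
    have ho₃ := (hF .order (by simp)).trans ho
    have ht₃ := (hF .termBase (by simp)).trans ht
    have ha₃ := (hF .adjBase (by simp)).trans ha
    refine (tot_validate hm₃ hlen₃ hpar₃ ho₃ ha₃ ((hF .bitsBase (by simp)).trans hb) hT₃ hk).mono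
      (Nat.mul_le_mul_left 400 (Nat.pow_le_pow_left (hle n hn) 3)) ?_
    rintro τ₄ ⟨hbad, hm₄, hF₄⟩
    refine ⟨n, hn, h1, h2, ?_, ?_⟩
    · have h₃ : Ready x n p τ₃ :=
        { len := hlen₃, param := hpar₃, order := ho₃, termBase := ht₃, adjBase := ha₃
          numT := hT₃, budget := hk, mem := fun i _ => by rw [hm₃] }
      exact h₃.of_frame hF₄ (fun i _ => by rw [hm₄, hm₃]) (by simp)
    · exact hbad
  · have : x.length + 1 ≤ (x.length + 1) ^ 3 := Nat.le_self_pow (by omega) _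
    omega

/-- A bound for the part of the running time that depends on the parameter. -/
def steinerTime (p : ℕ) : ℕ := 5000 * ((p ^ p + 1) ^ 2 * (p + 1) ^ 2)

open Classical in
-- The exponent 3 is due to validation, where two nested loops over the vertices contain a
-- multiplication by repeated addition; the searches are quadratic in the input length.
theorem tot_steinerProgram (x : List Bool) (p : ℕ) :
    Tot steinerProgram (initEnv x p) (steinerTime p * (x.length + 1) ^ 3) fun τ =>
      τ.reg .len ≠ 0 ↔ (x, p) ∈ terminalSteinerTree := by
  apply Tot.weaken
  · apply Tot.seq
    refine (tot_readInput x p).mono le_rfl ?_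
    rintro τ₁ ⟨n, hn, h1, h2, hR, hbad⟩
    have hnx : n + 1 ≤ x.length + 1 := by omega
    apply Tot.seq
    apply Tot.assign
    apply Tot.seq
    have hR₂ : Ready x n p (τ₁.set .ans 0) :=
      hR.of_frame (ms := [.ans]) ((Frame.refl _ _).set (by simp)) (fun _ _ => rfl) (by simp)
    apply Tot.ite (t := 400 * (x.length + 1) ^ 2 + (100 * (p + 1) ^ 2 +
      2000 * ((p ^ p + 1) ^ 2 * (p + 1) ^ 2 * (x.length + 1) ^ 2)))
    · intro hne
      have hne' : τ₁.reg .bad ≠ 0 := by simpa using hne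
      refine (Tot.skip ?_).weaken (by have := Nat.one_le_pow 2 (x.length + 1) (by omega); omega)
      apply Tot.assign
      rw [mem_terminalSteinerTree_iff h1 h2]
      simp only [Exp.eval, Env.reg_set, if_true, ne_eq, not_true_eq_false, false_iff]
      rintro ⟨hc, hp, -⟩
      exact hne' (hbad.2 ⟨hc, hp⟩)
    · intro heq
      have heq' : τ₁.reg .bad = 0 := by simpa using heq
      obtain ⟨hc, hp⟩ := hbad.1 heq'
      -- Positivity of `k` makes the default parent `0` legal and gives the tree at least one node.
      have hk := hc.codedK_pos h1 h2
      have hp1 : 1 ≤ p := by omega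
      have hn2 : (n + 1) ^ 2 ≤ (x.length + 1) ^ 2 := Nat.pow_le_pow_left hnx 2
      apply Tot.seq
      refine (tot_searchEdge hR₂ hc.1).mono (Nat.mul_le_mul_left 400 hn2) ?_
      rintro τ₂ ⟨hans₂, hm₂, hF₂⟩
      have hR₃ := hR₂.of_frame hF₂ (fun _ _ => by rw [hm₂]) (by simp)
      apply Tot.seq
      refine (tot_computeBound hR₃.param).mono le_rfl ?_
      rintro τ₃ ⟨hB, hm₃, hF₃⟩
      have hR₄ := hR₃.of_frame hF₃ (fun _ _ => by rw [hm₃]) (by simp)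
      refine (tot_searchTrees hR₄ hc.1 hp1 hB).mono
        (Nat.mul_le_mul_left 2000 (Nat.mul_le_mul_left _ hn2)) ?_
      intro τ₄ hans₄
      apply Tot.assign
      rw [mem_terminalSteinerTree_iff h1 h2]
      simp only [Exp.eval, Env.reg_set, if_true]
      rw [hans₄, hF₃ .ans (by simp), hans₂]
      simp only [Env.reg_set, if_true, ne_eq, not_true_eq_false, false_or]
      -- Every number yields a legal parent function because bad digits are replaced by `0`, and
      -- every legal parent function has a number below `p ^ p`.
      have htrees : (∃ m < p ^ p, TreeHom (slot n (codedK x n) (codedTerm x n)) (codedAdj x n)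
          (parentOf p (codedK x n) m) p) ↔
          ∃ par : ℕ → ℕ, (∀ j, 1 ≤ j → j < p → par j < j ∧ par j < codedK x n) ∧
            TreeHom (slot n (codedK x n) (codedTerm x n)) (codedAdj x n) par p := by
        constructor
        · rintro ⟨m, -, h⟩
          exact ⟨_, fun j hj _ => ⟨parentOf_lt hj, parentOf_lt_right hk⟩, h⟩
        · rintro ⟨par, hpar, h⟩
          obtain ⟨m, hm, he⟩ := exists_parentOf_eq par hpar
          exact ⟨m, hm, (treeHom_congr (fun _ _ _ => Iff.rfl) he).2 h⟩
      rw [htrees]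
      exact ⟨fun h => ⟨hc, hp, h⟩, fun h => h.2.2⟩
  · simp only [Exp.cost, steinerTime]
    have mono := fun {i j k : ℕ} => monomial_le_monomial (i := i) (j := j) (k := k) (I := 2)
      (J := 2) (K := 3) (Nat.le_add_left 1 (p ^ p)) (Nat.le_add_left 1 p)
      (Nat.le_add_left 1 x.length)
    have h₁ := mono (i := 0) (j := 0) (k := 3) (by omega) (by omega) (by omega)
    have h₂ := mono (i := 0) (j := 0) (k := 0) (by omega) (by omega) (by omega)
    have h₃ := mono (i := 0) (j := 0) (k := 2) (by omega) (by omega) (by omega)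
    have h₄ := mono (i := 0) (j := 2) (k := 0) (by omega) (by omega) (by omega)
    have h₅ := mono (i := 2) (j := 2) (k := 2) (by omega) (by omega) (by omega)
    rw [Nat.mul_assoc 5000]
    simp only [pow_zero, Nat.one_mul, Nat.mul_one] at h₁ h₂ h₃ h₄
    omega

theorem computable_steinerTime : Computable steinerTime := by
  have hpow : Primrec₂ (fun a b : ℕ => a ^ b) := Primrec₂.unpaired'.1 Nat.Primrec.pow
  have h1 : Primrec fun p : ℕ => p ^ p + 1 := Primrec.succ.comp (hpow.comp Primrec.id Primrec.id)
  have h2 : Primrec fun p : ℕ => p + 1 := Primrec.succ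
  have hsq : ∀ {g : ℕ → ℕ}, Primrec g → Primrec fun p => g p ^ 2 := fun hg =>
    hpow.comp hg (Primrec.const 2)
  exact (Primrec.nat_mul.comp (Primrec.const 5000)
    (Primrec.nat_mul.comp (hsq h1) (hsq h2))).to_comp

end RAM

/-- Terminal Steiner Tree parameterized by `k + |T|` is fixed-parameter tractable. -/
theorem mainTheorem9 : terminalSteinerTree.IsFPT := by
  refine ⟨RAM.steinerProgram, RAM.steinerTime, 3, RAM.computable_steinerTime, fun x p => ?_⟩
  obtain ⟨s, σ, t, hrun, ht, hs, h⟩ := RAM.tot_steinerProgram x p _ (RAM.realizes_init x p)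
  refine ⟨s, t, hrun, ht, ?_⟩
  -- The variable `len`, which receives the answer at the end, is kept in register `0`.
  rw [← h, ← hs.2 .len]
  rfl
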